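/- Let $K$ be a field of characteristic different from $2$, let $d\in K$ be a non-square, and let $\mathcal E$ be the Edwards curve $x^2+y^2=1+dx^2y^2$, with homogeneous coordinates $X,Y,Z$, $x=X/Z$, $y=Y/Z$. Let $\overline K$ be an algebraic closure of $K$ and $\overline K(\mathcal E)$ the function field of $\mathcal E$ over $\overline K$. The projective curve has exactly two singular points, both at infinity; for a divisor $D=\sum_Q n_Q Q$ supported on affine points of $\mathcal E$ let $$\mathcal L(D)=\{f\in\overline K(\mathcal E)^\ast : \operatorname{div}(f)+D \text{ is effective}\}\cup\{0\},$$ where zeros and poles are counted on the smooth projective model of $\mathcal E$ (that is, at all normalised discrete valuations of $\overline K(\mathcal E)$ that are trivial on $\overline K$), the affine points of $\mathcal E$ being identified with the points of the smooth model above them. Put $O=(0,1)$, $O'=(0,-1)$, $H=(1,0)$, $H'=(-1,0)$. Let $P=(a,b)$ be an affine point of $\mathcal E$ with $a,b\in K$, let $k\ge 0$ be an integer, and let $D=P+kO$, a divisor of degree $k+1$. Define $F_0=\frac ZZ=1$, $$F_1=\begin{cases}\dfrac ZX & \text{if } P=O',\\[2mm] \dfrac{(X+Z)(Y+Z)}{XY}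 & \text{if } P=H,\\[2mm] \dfrac{(X-Z)(Y+Z)}{XY} & \text{if } P=H',\\[2mm] \dfrac{(Y+bZ)X}{(X-aZ)(Y-Z)} & \text{if } P\notin\{O',H,H'\},\end{cases}$$ and, for $i\ge 2$, $$F_i=\begin{cases}\dfrac{Z^h}{(Y-Z)^h} & \text{if } i=2h,\\[2mm] \dfrac{(Y+Z)Z^h}{X(Y-Z)^h} & \text{if } i=2h+1.\end{cases}$$ Then $\dim_{\overline K}\mathcal L(D)=k+1$. If $P\ne O$, then $F_0,F_1,\dots,F_k$ is a $\overline K$-basis of $\mathcal L(D)$. If $P=O$, then the $k+1$ functions $F_0,F_2,F_3,\dots,F_{k+1}$ (only $F_0$ when $k=0$) form a $\overline K$-basis of $\mathcal L(D)$. -/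

import Mathlib

open Polynomial
open scoped Polynomial.Bivariate WithZero

/-- An Edwards curve `x² + y² = 1 + d x² y²`, with `d (d - 1) ≠ 0`, over a field of
characteristic different from `2`. -/
structure EdwardsCurve (K : Type*) [Field K] where
  /-- the coefficient `d` -/
  d : K
  two_ne_zero : (2 : K) ≠ 0
  d_ne_zero : d ≠ 0
  d_ne_one : d ≠ 1

/-- A place of a field extension `M` of `F`: a normalised (i.e. surjective onto `ℤ ∪ {∞}`, written
multiplicatively) discrete valuation of `M` that is trivial on `F`. When `F` is algebraically
closed and `M` is the function field of a curve over `F`, the places are the points of the smooth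
projective model of the curve. -/
structure Place (F M : Type*) [Field F] [Field M] [Algebra F M] where
  /-- the valuation, in multiplicative notation -/
  val : Valuation M ℤᵐ⁰
  val_algebraMap : ∀ c : F, c ≠ 0 → val (algebraMap F M c) = 1
  surjective : Function.Surjective val

/-- The order of vanishing of a function `f ≠ 0` at the place `v` (positive at zeros of `f`,
negative at poles). -/
noncomputable def Place.ord {F M : Type*} [Field F] [Field M] [Algebra F M]
    (v : Place F M) (f : M) : ℤ :=
  -WithZero.log (v.val f)

theorem Place.le_ord_iff {F M : Type*} [Field F] [Field M] [Algebra F M]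
    (v : Place F M) {f : M} (hf : f ≠ 0) (n : ℤ) :
    0 ≤ v.ord f + n ↔ v.val f ≤ WithZero.exp n := by
  have h : v.val f ≠ 0 := (Valuation.ne_zero_iff _).2 hf
  rw [← WithZero.log_le_iff_le_exp h, Place.ord]
  constructor <;> intro h' <;> linarith

namespace EdwardsCurve

variable {K : Type*} [Field K] (E : EdwardsCurve K)

/-- The same curve over an extension field. -/
def baseChange (F : Type*) [Field F] [Algebra K F] : EdwardsCurve F where
  d := algebraMap K F E.d
  two_ne_zero := by
    have h := (map_ne_zero (algebraMap K F)).2 E.two_ne_zero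
    rwa [map_ofNat] at h
  d_ne_zero := (map_ne_zero (algebraMap K F)).2 E.d_ne_zero
  d_ne_one := fun h => E.d_ne_one ((algebraMap K F).injective (by rw [h, map_one]))

/-- The polynomial `X² + Y² - (1 + d X² Y²)` in `K[X][Y]`. -/
noncomputable def polynomial : K[X][Y] :=
  C X ^ 2 + Y ^ 2 - (1 + C (C E.d) * C X ^ 2 * Y ^ 2)

theorem polynomial_eq :
    E.polynomial = C (1 - C E.d * X ^ 2) * Y ^ 2 + C 0 * Y + C (X ^ 2 - 1) := by
  simp only [polynomial, map_sub, map_mul, map_pow, map_one, map_zero]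
  ring

theorem coeff_quadratic {R : Type*} [CommRing R] (p q r : R) :
    (C p * X ^ 2 + C q * X + C r).coeff 0 = r ∧ (C p * X ^ 2 + C q * X + C r).coeff 1 = q ∧
      (C p * X ^ 2 + C q * X + C r).coeff 2 = p := by
  refine ⟨?_, ?_, ?_⟩ <;>
    simp only [coeff_add, coeff_C_mul, coeff_X_pow, coeff_X, coeff_C] <;> norm_num

theorem irreducible_polynomial : Irreducible E.polynomial := by
  have hlead : (1 - C E.d * X ^ 2 : K[X]) ≠ 0 := by
    intro h
    have := congrArg (Polynomial.eval 0) h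
    simp at this
  have hdeg : E.polynomial.natDegree = 2 := by
    rw [polynomial_eq]; exact natDegree_quadratic hlead
  have h0 : E.polynomial ≠ 0 := by
    intro h; rw [h] at hdeg; simp at hdeg
  have hc0 : E.polynomial.coeff 0 = X ^ 2 - 1 := by
    rw [polynomial_eq]; exact (coeff_quadratic _ _ _).1
  have hc1 : E.polynomial.coeff 1 = 0 := by
    rw [polynomial_eq]; exact (coeff_quadratic _ _ _).2.1
  have hc2 : E.polynomial.coeff 2 = 1 - C E.d * X ^ 2 := by
    rw [polynomial_eq]; exact (coeff_quadratic _ _ _).2.2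
  have hconst : ∀ c : K[X], C c ∣ E.polynomial → IsUnit c := by
    intro c hc
    rw [C_dvd_iff_dvd_coeff] at hc
    have h1 := hc 0
    have h2 := hc 2
    rw [hc0] at h1
    rw [hc2] at h2
    have h3 : c ∣ C (1 - E.d) := by
      have := dvd_add h2 (h1.mul_left (C E.d))
      convert this using 1
      simp only [map_sub, map_one]; ring
    exact isUnit_of_dvd_unit h3 (isUnit_C.2 (sub_ne_zero.2 E.d_ne_one.symm).isUnit)
  refine ⟨fun h => by have := natDegree_eq_zero_of_isUnit h; omega, ?_⟩
  intro f g hfg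
  have hf0 : f ≠ 0 := by rintro rfl; exact h0 (by simpa using hfg)
  have hg0 : g ≠ 0 := by rintro rfl; exact h0 (by simpa using hfg)
  have hsum : f.natDegree + g.natDegree = 2 := by
    rw [← natDegree_mul hf0 hg0, ← hfg, hdeg]
  have hcase : f.natDegree = 0 ∨ g.natDegree = 0 ∨ (f.natDegree ≤ 1 ∧ g.natDegree ≤ 1) := by
    omega
  rcases hcase with h | h | ⟨hf, hg⟩
  · left
    rw [eq_C_of_natDegree_eq_zero h] at hfg ⊢
    exact isUnit_C.2 (hconst _ ⟨g, hfg⟩)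
  · right
    rw [eq_C_of_natDegree_eq_zero h] at hfg ⊢
    exact isUnit_C.2 (hconst _ ⟨f, by rw [hfg]; ring⟩)
  · exfalso
    obtain ⟨a, b, rfl⟩ := exists_eq_X_add_C_of_natDegree_le_one hf
    obtain ⟨a', b', rfl⟩ := exists_eq_X_add_C_of_natDegree_le_one hg
    have hexp : E.polynomial = C (a * a') * Y ^ 2 + C (a * b' + b * a') * Y + C (b * b') := by
      rw [hfg]; simp only [map_mul, map_add]; ring
    have e0 : X ^ 2 - 1 = b * b' := by
      rw [← hc0, hexp]; exact (coeff_quadratic _ _ _).1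
    have e1 : 0 = a * b' + b * a' := by
      rw [← hc1, hexp]; exact (coeff_quadratic _ _ _).2.1
    have e2 : 1 - C E.d * X ^ 2 = a * a' := by
      rw [← hc2, hexp]; exact (coeff_quadratic _ _ _).2.2
    have hsq : (a * b') ^ 2 = (1 - C E.d * X ^ 2) * (1 - X ^ 2) := by
      linear_combination (-(a * b')) * e1 + (1 - C E.d * X ^ 2) * e0 + (b * b') * e2
    have hev : (Polynomial.eval 1 (a * b')) = 0 := by
      have := congrArg (Polynomial.eval 1) hsq
      simpa using this
    have hder := congrArg (fun p => Polynomial.eval 1 (derivative p)) hsq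
    simp only [pow_two, derivative_mul, derivative_sub, derivative_one, derivative_X,
      derivative_C, eval_add, eval_mul, eval_sub, eval_one, eval_X, eval_C, eval_zero] at hder
    rw [eval_mul] at hev
    have : (1 - E.d) * 2 = 0 := by
      linear_combination (1 : K) * hder - (2 * (Polynomial.eval 1 (derivative a) *
        Polynomial.eval 1 b' + Polynomial.eval 1 a * Polynomial.eval 1 (derivative b'))) * hev
    rcases mul_eq_zero.1 this with h | h
    · exact E.d_ne_one (sub_eq_zero.1 h).symm
    · exact E.two_ne_zero h

/-- The affine coordinate ring `K[X, Y] / (X² + Y² - 1 - d X² Y²)`. -/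
abbrev CoordinateRing : Type _ :=
  AdjoinRoot E.polynomial

instance : IsDomain E.CoordinateRing :=
  AdjoinRoot.isDomain_of_prime E.irreducible_polynomial.prime

/-- The function field of the curve. -/
abbrev FunctionField : Type _ :=
  FractionRing E.CoordinateRing

/-- The coordinate function `x = X / Z`. -/
noncomputable def x : E.FunctionField :=
  algebraMap E.CoordinateRing E.FunctionField (AdjoinRoot.of E.polynomial X)

/-- The coordinate function `y = Y / Z`. -/
noncomputable def y : E.FunctionField :=
  algebraMap E.CoordinateRing E.FunctionField (AdjoinRoot.root E.polynomial)

/-- The affine points `(a, b)` of the curve with coordinates in the base field, i.e. the points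
different from the two singular points at infinity. -/
@[ext]
structure AffinePoint where
  /-- the `x`-coordinate -/
  a : K
  /-- the `y`-coordinate -/
  b : K
  equation : a ^ 2 + b ^ 2 = 1 + E.d * a ^ 2 * b ^ 2

namespace AffinePoint

variable {E}

/-- A point of the curve, seen over an extension field. -/
def baseChange (P : E.AffinePoint) (F : Type*) [Field F] [Algebra K F] :
    (E.baseChange F).AffinePoint where
  a := algebraMap K F P.a
  b := algebraMap K F P.b
  equation := by
    have h := congrArg (algebraMap K F) P.equation
    simpa [EdwardsCurve.baseChange] using h

variable (E)

/-- The point `O = (0, 1)`. -/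
def O : E.AffinePoint := ⟨0, 1, by ring⟩

/-- The point `O' = (0, -1)`. -/
def O' : E.AffinePoint := ⟨0, -1, by ring⟩

/-- The point `H = (1, 0)`. -/
def H : E.AffinePoint := ⟨1, 0, by ring⟩

/-- The point `H' = (-1, 0)`. -/
def H' : E.AffinePoint := ⟨-1, 0, by ring⟩

end AffinePoint

/-- Divisors on the curve whose support does not contain the two singular points at infinity. -/
abbrev Divisor : Type _ := E.AffinePoint →₀ ℤ

variable {E}

/-- The place `v` lies over the affine point `P = (a, b)` if `x - a` and `y - b` vanish at `v`. -/
def LiesOver (v : Place K E.FunctionField) (P : E.AffinePoint) : Prop :=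
  v.val (E.x - algebraMap K E.FunctionField P.a) < 1 ∧
    v.val (E.y - algebraMap K E.FunctionField P.b) < 1

open Classical in
/-- The coefficient at the place `v` of a divisor `D`: it is `D P` if `v` lies over an affine point
`P` (all affine points are non-singular), and `0` for the places over the points at infinity. -/
noncomputable def Divisor.coeffAt (D : E.Divisor) (v : Place K E.FunctionField) : ℤ :=
  D.sum fun P n => if LiesOver v P then n else 0

/-- The Riemann-Roch space `L(D)`: all `f` with `f = 0` or `div f + D` effective. -/
noncomputable def riemannRochSpace (D : E.Divisor) : Submodule K E.FunctionField where
  carrier := {f | f = 0 ∨ ∀ v : Place K E.FunctionField, 0 ≤ v.ord f + D.coeffAt v}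
  zero_mem' := Or.inl rfl
  add_mem' := by
    intro f g hf hg
    rcases eq_or_ne f 0 with rfl | hf0
    · simpa using hg
    rcases eq_or_ne g 0 with rfl | hg0
    · simpa using hf
    rcases eq_or_ne (f + g) 0 with h | h
    · exact Or.inl h
    refine Or.inr fun v => ?_
    rw [v.le_ord_iff h]
    exact v.val.map_add_le ((v.le_ord_iff hf0 _).1 ((hf.resolve_left hf0) v))
      ((v.le_ord_iff hg0 _).1 ((hg.resolve_left hg0) v))
  smul_mem' := by
    intro c f hf
    rcases eq_or_ne f 0 with rfl | hf0
    · left; simp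
    rcases eq_or_ne c 0 with rfl | hc
    · left; simp
    refine Or.inr fun v => ?_
    have h := (hf.resolve_left hf0) v
    rw [Algebra.smul_def]
    simpa [Place.ord, map_mul, v.val_algebraMap c hc] using h

open Classical in
/-- The functions `F₀, F₁, F₂, …` attached to the point `P = (a, b)`, written in the affine
coordinates `x = X / Z`, `y = Y / Z`. -/
noncomputable def basisFun (P : E.AffinePoint) (i : ℕ) : E.FunctionField :=
  if i = 0 then 1
  else if i = 1 then
    if P = AffinePoint.O' E then 1 / E.x
    else if P = AffinePoint.H E then (E.x + 1) * (E.y + 1) / (E.x * E.y)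
    else if P = AffinePoint.H' E then (E.x - 1) * (E.y + 1) / (E.x * E.y)
    else (E.y + algebraMap K E.FunctionField P.b) * E.x /
      ((E.x - algebraMap K E.FunctionField P.a) * (E.y - 1))
  else if Even i then 1 / (E.y - 1) ^ (i / 2)
  else (E.y + 1) / (E.x * (E.y - 1) ^ (i / 2))

end EdwardsCurve

/-!
The Riemann-Roch space `L(P + k O)` is filtered by the order of the pole at `O`. Since `O` lies under
a single place `v₀`, whose residue field is the base field, each step of the filtration has
dimension at most one, and the theorem follows from two facts. The first is that the `i`-th function
of the family has a pole of order exactly `i` at `O` and no other poles, except that the function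
`F₁` may have a simple pole at `P`. The second is that `L(P)` contains only constants. The argument
works over an arbitrary base field: the equation alone shows that `1 - d a²` does not vanish at an
affine point `(a, b)`, so that `x = a` meets the affine curve in `(a, b)` and `(a, -b)` only.

The second fact (`IsEdwardsPair.exists_eq_algebraMap`) says that the genus is positive. Let `f` have
at most a simple pole at `P = (a, b)`, and write `(x - a) f = U + V y` with `U`, `V` in `F(x)`. This
function is regular where `x` is finite, and its quotient by `x` is regular where `1 / x` is finite.
A function that is regular at all places where `t` is finite is integral over `F[t]`, because the
integral closure of `F[t]` is a Dedekind domain and its maximal ideals are such places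
(`isIntegral_of_forall_place_le_one`). Taking traces and norms, `2 U` is a polynomial of degree at
most `1` and `V² y² = V² (1 - x²) / (1 - d x²)` is one of degree at most `2`. As
`(1 - x²) (1 - d x²)` is squarefree of degree `4`, this forces `V = 0`, so `(x - a) f` is linear in
`x`. By the symmetry of the equation `(y - b) f` is linear in `y`, and both hold only if `f` is
constant, because `y` is not in `F(x)`.

The local statements rest on uniformizers (`IsUniformizerAt`): `x - a` at points with `b ≠ 0` and,
symmetrically, `y - b` at points with `a ≠ 0`. Every function is a power of the uniformizer times a
unit that has a nonzero value in the base field, and this determines the valuation. A place over `O`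
exists, since otherwise `1 / (y - 1)` would have no poles.
-/

/-! ### Rational functions of one variable -/

section Polynomials
variable {F : Type*} [Field F]

theorem separable_one_sub_C_mul_X_sq {d : F} (h2 : (2 : F) ≠ 0) :
    (1 - C d * X ^ 2 : F[X]).Separable := by
  refine ⟨1, C (-(1 / 2)) * X, ?_⟩
  have h : (C (1 / 2) * C 2 : F[X]) = 1 := by
    rw [← C_mul, one_div, inv_mul_cancel₀ h2, C_1]
  simp only [derivative_sub, derivative_one, derivative_mul, derivative_C, derivative_X_pow, C_neg,
    Nat.cast_ofNat]
  linear_combination (C d * X ^ 2) * h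

theorem natDegree_one_sub_C_mul_X_sq {d : F} (hd : d ≠ 0) :
    (1 - C d * X ^ 2 : F[X]).natDegree = 2 := by
  have : (1 - C d * X ^ 2 : F[X]) = C (-d) * X ^ 2 + C 0 * X + C 1 := by
    simp only [C_neg, C_0, C_1]; ring
  rw [this]
  exact natDegree_quadratic (neg_ne_zero.2 hd)

/-- The quartic `(1 - X²)(1 - d X²)` is squarefree, so `q · (1 - d X²) / (1 - X²)` can only be the
square of a rational function `m / n` if `q = 0` or `q` has degree at least `4`. -/
theorem eq_zero_of_sq_mul_eq {d : F} (h2 : (2 : F) ≠ 0) (hd : d ≠ 0) (hd1 : d ≠ 1)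
    {m n q : F[X]} (hn : n ≠ 0) (hq : q.natDegree ≤ 2)
    (h : m ^ 2 * (1 - C 1 * X ^ 2) = n ^ 2 * (q * (1 - C d * X ^ 2)))
    (hmn : IsCoprime m n) : m = 0 := by
  by_contra hm
  have hsep1 := separable_one_sub_C_mul_X_sq (d := 1) h2
  have hsepd := separable_one_sub_C_mul_X_sq (d := d) h2
  have hdeg1 := natDegree_one_sub_C_mul_X_sq (one_ne_zero (α := F))
  have hdegd := natDegree_one_sub_C_mul_X_sq hd
  have hne1 : (1 - C 1 * X ^ 2 : F[X]) ≠ 0 := hsep1.ne_zero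
  have hned : (1 - C d * X ^ 2 : F[X]) ≠ 0 := hsepd.ne_zero
  have hnu : IsUnit n := by
    apply hsep1.squarefree n
    rw [← pow_two]
    exact (hmn.symm.pow (m := 2) (n := 2)).dvd_of_dvd_mul_left ⟨_, h⟩
  have hn0 : n.natDegree = 0 := natDegree_eq_zero_of_isUnit hnu
  have hcop : IsCoprime (1 - C d * X ^ 2 : F[X]) (1 - C 1 * X ^ 2) := by
    refine ⟨C (1 - d)⁻¹, -C ((1 - d)⁻¹ * d), ?_⟩
    have : (C (1 - d)⁻¹ * (1 - C d) : F[X]) = 1 := by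
      rw [← C_1, ← C_sub, ← C_mul, inv_mul_cancel₀ (sub_ne_zero.2 hd1.symm)]
    simp only [C_mul, C_1]
    linear_combination this
  have hdvd : (1 - C d * X ^ 2 : F[X]) ∣ m := by
    refine (hsepd.squarefree.dvd_pow_iff_dvd two_ne_zero).1 ?_
    exact hcop.dvd_of_dvd_mul_right ⟨n ^ 2 * q, by rw [h]; ring⟩
  have hmdeg : 2 ≤ m.natDegree := hdegd ▸ natDegree_le_of_dvd hdvd hm
  have hq0 : q ≠ 0 := by
    rintro rfl
    rw [zero_mul, mul_zero] at h
    exact mul_ne_zero (pow_ne_zero 2 hm) hne1 h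
  have := congrArg natDegree h
  rw [natDegree_mul (pow_ne_zero _ hm) hne1, natDegree_mul (pow_ne_zero _ hn)
    (mul_ne_zero hq0 hned), natDegree_mul hq0 hned, natDegree_pow, natDegree_pow, hn0, hdeg1,
    hdegd] at this
  omega

end Polynomials

section SimpleExtension
variable {F M : Type*} [Field F] [Field M] [Algebra F M]
open IntermediateField

/-- The pole of `s` at `x = ∞` has order at most `k`, so `s ∈ F[x]` is a polynomial of degree at
most `k`. -/
theorem exists_natDegree_le_of_mem_adjoin_inv {x s : M} (hx : Transcendental F x) (k : ℕ)
    (hs : s ∈ Algebra.adjoin F {x}) (hs' : s * x⁻¹ ^ k ∈ Algebra.adjoin F {x⁻¹}) :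
    ∃ p : F[X], p.natDegree ≤ k ∧ s = aeval x p := by
  have hx0 : x ≠ 0 := by rintro rfl; exact hx isAlgebraic_zero
  rw [Algebra.adjoin_singleton_eq_range_aeval] at hs hs'
  obtain ⟨p, rfl⟩ := hs
  obtain ⟨r, hr⟩ := hs'
  refine ⟨p, ?_, rfl⟩
  rcases eq_or_ne p 0 with rfl | hp
  · simp
  have hrev : aeval x r.reverse * x⁻¹ ^ r.natDegree = aeval x p * x⁻¹ ^ k := by
    let := invertibleOfNonzero (inv_ne_zero hx0)
    have h := eval₂_reverse_mul_pow (algebraMap F M) x⁻¹ r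
    rw [invOf_eq_inv, inv_inv] at h
    exact h.trans hr
  have key : aeval x (p * X ^ r.natDegree) = aeval x (X ^ k * r.reverse) := by
    simp only [map_mul, map_pow, aeval_X]
    rw [inv_pow, inv_pow, ← div_eq_mul_inv, ← div_eq_mul_inv,
      div_eq_div_iff (pow_ne_zero _ hx0) (pow_ne_zero _ hx0)] at hrev
    rw [← hrev, mul_comm]
  have hinj := transcendental_iff_injective.1 hx key
  have hr0 : r.reverse ≠ 0 := fun h0 ↦ by
    rw [h0, mul_zero] at hinj
    exact mul_ne_zero hp (pow_ne_zero _ X_ne_zero) hinj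
  have := congrArg natDegree hinj
  rw [natDegree_mul hp (pow_ne_zero _ X_ne_zero), natDegree_mul (pow_ne_zero _ X_ne_zero) hr0,
    natDegree_X_pow, natDegree_X_pow] at this
  have := r.reverse_natDegree_le
  omega

/-- An element `r` of `F(x)` such that `r² (1 - x²) / (1 - d x²)` is a polynomial in `x` of degree
at most `2` vanishes. -/
theorem eq_zero_of_mem_adjoin_of_sq_mul_eq {d : F} (h2 : (2 : F) ≠ 0) (hd : d ≠ 0) (hd1 : d ≠ 1)
    {x r : M} (hx : Transcendental F x) (hr : r ∈ F⟮x⟯) {q : F[X]} (hq : q.natDegree ≤ 2)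
    (h : r ^ 2 * (1 - x ^ 2) = aeval x q * (1 - algebraMap F M d * x ^ 2)) : r = 0 := by
  obtain ⟨m, n, rfl⟩ := (mem_adjoin_simple_iff F r).1 hr
  have hinj := transcendental_iff_injective.1 hx
  by_cases hn : aeval x n = 0
  · rw [hn, div_zero]
  have hn0 : n ≠ 0 := by rintro rfl; simp at hn
  classical
  let := EuclideanDomain.gcdMonoid F[X]
  obtain ⟨m', n', hm', hn', hu⟩ := extract_gcd m n
  set g := gcd m n
  have hg : aeval x g ≠ 0 := fun h0 ↦ hn (by rw [hn', map_mul, h0, zero_mul])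
  have hn1 : aeval x n' ≠ 0 := fun h0 ↦ hn (by rw [hn', map_mul, h0, mul_zero])
  rw [hm', hn', map_mul, map_mul, mul_div_mul_left _ _ hg] at h ⊢
  have hpoly : m' ^ 2 * (1 - C 1 * X ^ 2) = n' ^ 2 * (q * (1 - C d * X ^ 2)) := by
    apply hinj
    simp only [map_mul, map_pow, map_sub, map_one, aeval_X, aeval_C, one_mul]
    field_simp at h
    linear_combination h
  have hm0 := eq_zero_of_sq_mul_eq h2 hd hd1 (by rintro rfl; simp at hn1) hq hpoly
    ((gcd_isUnit_iff _ _).1 hu)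
  rw [hm0, map_zero, zero_div]

end SimpleExtension

/-! ### Integrality of functions without poles -/

section Integrality
variable {F M : Type*} [Field F] [Field M] [Algebra F M]
open IntermediateField
open scoped IntermediateField.algebraAdjoinAdjoin

/-- The place attached to a maximal ideal of a Dedekind domain containing the constants. -/
noncomputable def Place.ofHeightOneSpectrum {B : Type*} [CommRing B] [IsDedekindDomain B]
    [Algebra F B] [Algebra B M] [IsScalarTower F B M] [IsFractionRing B M]
    (w : IsDedekindDomain.HeightOneSpectrum B) : Place F M where
  val := w.valuation M
  val_algebraMap c hc := by
    have h : ∀ c : F, w.valuation M (algebraMap F M c) ≤ 1 := fun c ↦ by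
      rw [IsScalarTower.algebraMap_apply F B M]
      exact w.valuation_le_one _
    refine le_antisymm (h c) ?_
    have hc' : w.valuation M (algebraMap F M c) ≠ 0 :=
      (Valuation.ne_zero_iff _).2 ((_root_.map_ne_zero _).2 hc)
    have := h c⁻¹
    rwa [map_inv₀, map_inv₀, inv_le_one₀ (zero_lt_iff.2 hc')] at this
  surjective := w.valuation_surjective M

theorem isPrincipalIdealRing_adjoin_singleton {x : M} (hx : Transcendental F x) :
    IsPrincipalIdealRing (Algebra.adjoin F {x}) :=
  IsPrincipalIdealRing.of_surjective (algEquivOfTranscendental F x hx)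
    (algEquivOfTranscendental F x hx).surjective

/-- A function that is regular at all places where `x` is finite is integral over `F[x]`. -/
theorem isIntegral_of_forall_place_le_one {x : M} (hx : Transcendental F x)
    [FiniteDimensional F⟮x⟯ M] [Algebra.IsSeparable F⟮x⟯ M] {z : M}
    (hz : ∀ v : Place F M, v.val x ≤ 1 → v.val z ≤ 1) :
    IsIntegral (Algebra.adjoin F {x}) z := by
  have := isPrincipalIdealRing_adjoin_singleton hx
  let B := integralClosure (Algebra.adjoin F {x}) M
  have : IsDedekindDomain B := integralClosure.isDedekindDomain _ F⟮x⟯ M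
  have : IsFractionRing B M :=
    IsIntegralClosure.isFractionRing_of_finite_extension (Algebra.adjoin F {x}) F⟮x⟯ M B
  obtain ⟨b, rfl⟩ := IsDedekindDomain.HeightOneSpectrum.mem_integers_of_valuation_le_one M z
    fun w : IsDedekindDomain.HeightOneSpectrum B ↦ hz (Place.ofHeightOneSpectrum w) (w.valuation_le_one
      (algebraMap (Algebra.adjoin F {x}) B ⟨x, Algebra.self_mem_adjoin_singleton F x⟩))
  exact b.2

/-- The trace and the norm of an integral element of a quadratic extension are integral. -/
theorem mem_range_of_isIntegral_add_mul_sqrt {A K : Type*} [CommRing A] [IsDomain A]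
    [IsIntegrallyClosed A] [Field K] [Algebra A K] [IsFractionRing A K] [Algebra A M] [Algebra K M]
    [IsScalarTower A K M] {c U V : K} {y : M} (hy : y ^ 2 = algebraMap K M c)
    (hyK : y ∉ (algebraMap K M).range)
    (h : IsIntegral A (algebraMap K M U + algebraMap K M V * y)) :
    2 * U ∈ (algebraMap A K).range ∧ U ^ 2 - V ^ 2 * c ∈ (algebraMap A K).range := by
  rcases eq_or_ne V 0 with rfl | hV
  · rw [map_zero, zero_mul, add_zero, isIntegral_algebraMap_iff (algebraMap K M).injective] at h
    obtain ⟨u, rfl⟩ := IsIntegrallyClosed.algebraMap_eq_of_integral h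
    exact ⟨⟨2 * u, by rw [map_mul, map_ofNat]⟩, ⟨u ^ 2, by simp⟩⟩
  set z := algebraMap K M U + algebraMap K M V * y with hz
  have hzK : z ∉ (algebraMap K M).range := by
    rintro ⟨w, hw⟩
    refine hyK ⟨(w - U) / V, ?_⟩
    have hV' : algebraMap K M V ≠ 0 := (_root_.map_ne_zero _).2 hV
    rw [map_div₀, map_sub, hw, hz]
    field_simp
    ring
  have hint : IsIntegral K z := h.tower_top
  set p : K[X] := X ^ 2 + C (-(2 * U)) * X + C (U ^ 2 - V ^ 2 * c) with hp
  have hp' : p = C 1 * X ^ 2 + C (-(2 * U)) * X + C (U ^ 2 - V ^ 2 * c) := by rw [C_1, one_mul]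
  have hroot : aeval z p = 0 := by
    simp only [hp, map_add, map_mul, map_pow, aeval_X, aeval_C, map_neg, map_sub, map_ofNat]
    rw [← hy, hz]
    ring
  have hmin : minpoly K z = p := by
    refine eq_of_dvd_of_natDegree_le_of_leadingCoeff (minpoly.dvd K z hroot) ?_ ?_
    · rw [hp', natDegree_quadratic one_ne_zero]
      exact (minpoly.two_le_natDegree_iff hint).2 hzK
    · rw [(minpoly.monic hint).leadingCoeff, hp', leadingCoeff_quadratic one_ne_zero]
  have hcoeff : ∀ n, p.coeff n ∈ (algebraMap A K).range := fun n ↦ by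
    rw [← hmin, minpoly.isIntegrallyClosed_eq_field_fractions' K h, coeff_map]
    exact ⟨_, rfl⟩
  have hcs := EdwardsCurve.coeff_quadratic (1 : K) (-(2 * U)) (U ^ 2 - V ^ 2 * c)
  rw [← hp'] at hcs
  refine ⟨?_, hcs.1 ▸ hcoeff 0⟩
  have := hcoeff 1
  rw [hcs.2.1] at this
  simpa using neg_mem this

end Integrality

/-- Generators `x`, `y` of a field `M` over `F` satisfying the Edwards equation, with `x`
transcendental: `M` is the function field of the Edwards curve. The notion is symmetric
in `x` and `y`. -/
structure IsEdwardsPair {F M : Type*} [Field F] [Field M] [Algebra F M] (d : F) (x y : M) :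
    Prop where
  two_ne_zero : (2 : F) ≠ 0
  d_ne_zero : d ≠ 0
  d_ne_one : d ≠ 1
  equation : x ^ 2 + y ^ 2 = 1 + algebraMap F M d * x ^ 2 * y ^ 2
  transcendental : Transcendental F x
  adjoin_eq_top : IntermediateField.adjoin F {x, y} = ⊤

namespace IsEdwardsPair
variable {F M : Type*} [Field F] [Field M] [Algebra F M] {d : F} {x y : M}
open IntermediateField
open scoped IntermediateField.algebraAdjoinAdjoin

theorem sq_mul_eq (h : IsEdwardsPair d x y) :
    y ^ 2 * (1 - algebraMap F M d * x ^ 2) = 1 - x ^ 2 := by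
  linear_combination h.equation

theorem one_sub_ne_zero (h : IsEdwardsPair d x y) : 1 - algebraMap F M d * x ^ 2 ≠ 0 := by
  intro h0
  have : aeval x (1 - C d * X ^ 2 : F[X]) = 0 := by simpa using h0
  have := transcendental_iff.1 h.transcendental _ this
  exact (separable_one_sub_C_mul_X_sq (d := d) h.two_ne_zero).ne_zero this

theorem sq_eq (h : IsEdwardsPair d x y) :
    y ^ 2 = (1 - x ^ 2) / (1 - algebraMap F M d * x ^ 2) := by
  rw [eq_div_iff h.one_sub_ne_zero, h.sq_mul_eq]

theorem symm (h : IsEdwardsPair d x y) : IsEdwardsPair d y x where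
  two_ne_zero := h.two_ne_zero
  d_ne_zero := h.d_ne_zero
  d_ne_one := h.d_ne_one
  equation := by linear_combination h.equation
  adjoin_eq_top := by rw [Set.pair_comm, h.adjoin_eq_top]
  transcendental := by
    intro hy
    have hone : IsAlgebraic F (1 : M) := isAlgebraic_one
    have hz : 1 - algebraMap F M d * y ^ 2 ≠ 0 := by
      intro h0
      have h1 : 1 - y ^ 2 = 0 := by linear_combination x ^ 2 * h0 - h.equation
      have h2 : algebraMap F M (1 - d) = 0 := by
        rw [map_sub, map_one]
        linear_combination h0 - algebraMap F M d * h1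
      exact sub_ne_zero.2 h.d_ne_one.symm ((map_eq_zero _).1 h2)
    have hx : x ^ 2 = (1 - y ^ 2) * (1 - algebraMap F M d * y ^ 2)⁻¹ := by
      rw [← div_eq_mul_inv, eq_div_iff hz]
      linear_combination h.equation
    refine h.transcendental (IsAlgebraic.of_pow (n := 2) two_pos ?_)
    rw [hx]
    exact (hone.sub (hy.pow 2)).mul
      (hone.sub ((isAlgebraic_algebraMap d).mul (hy.pow 2))).inv

theorem sq_mem (h : IsEdwardsPair d x y) : y ^ 2 ∈ F⟮x⟯ := by
  have hx := mem_adjoin_simple_self F x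
  rw [h.sq_eq]
  exact div_mem (sub_mem (one_mem _) (pow_mem hx 2))
    (sub_mem (one_mem _) (mul_mem (IntermediateField.algebraMap_mem _ _) (pow_mem hx 2)))

theorem notMem (h : IsEdwardsPair d x y) : y ∉ F⟮x⟯ := by
  intro hy
  have hy0 : y ≠ 0 := fun h0 ↦ h.symm.transcendental (h0 ▸ isAlgebraic_zero)
  refine inv_ne_zero hy0 (eq_zero_of_mem_adjoin_of_sq_mul_eq h.two_ne_zero h.d_ne_zero h.d_ne_one
    h.transcendental (inv_mem hy) (q := 1) (by simp) ?_)
  rw [map_one, one_mul, ← h.sq_mul_eq, inv_pow, inv_mul_cancel_left₀ (pow_ne_zero _ hy0)]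

theorem isIntegral (h : IsEdwardsPair d x y) : IsIntegral F⟮x⟯ y :=
  IsIntegral.of_pow two_pos
    (isIntegral_algebraMap (R := F⟮x⟯) (x := (⟨y ^ 2, h.sq_mem⟩ : F⟮x⟯)) : IsIntegral F⟮x⟯ (y ^ 2))

theorem adjoin_adjoin_eq_top (h : IsEdwardsPair d x y) : F⟮x⟯⟮y⟯ = ⊤ := by
  rw [← restrictScalars_eq_top_iff (K := F), adjoin_adjoin_left, ← h.adjoin_eq_top]
  rfl

theorem finiteDimensional (h : IsEdwardsPair d x y) : FiniteDimensional F⟮x⟯ M := by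
  have := adjoin.finiteDimensional h.isIntegral
  rw [h.adjoin_adjoin_eq_top] at this
  exact Module.Finite.equiv (topEquiv (F := F⟮x⟯) (E := M)).toLinearEquiv

theorem isSeparable (h : IsEdwardsPair d x y) : Algebra.IsSeparable F⟮x⟯ M := by
  have hsep : IsSeparable F⟮x⟯ y := by
    set c : F⟮x⟯ := ⟨y ^ 2, h.sq_mem⟩ with hc
    have hc0 : c ≠ 0 := by
      intro h0
      have : y ^ 2 = 0 := congrArg Subtype.val h0
      exact h.notMem ((pow_eq_zero_iff _root_.two_ne_zero).1 this ▸ zero_mem _)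
    have h2 : (2 : F⟮x⟯) ≠ 0 := by
      have := (map_ne_zero (algebraMap F F⟮x⟯)).2 h.two_ne_zero
      rwa [map_ofNat] at this
    have hs : (X ^ 2 - C c : (F⟮x⟯)[X]).Separable :=
      separable_X_pow_sub_C c (by exact_mod_cast h2) hc0
    refine hs.of_dvd (minpoly.dvd _ _ ?_)
    rw [map_sub, map_pow, aeval_X, aeval_C]
    exact sub_self (y ^ 2)
  have := (isSeparable_adjoin_simple_iff_isSeparable F⟮x⟯ M).2 hsep
  rw [h.adjoin_adjoin_eq_top] at this
  exact Algebra.IsSeparable.of_algHom F⟮x⟯ _ (topEquiv (F := F⟮x⟯) (E := M)).symm.toAlgHom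

theorem exists_eq_add_mul (h : IsEdwardsPair d x y) (f : M) :
    ∃ u v : F⟮x⟯, f = u + v * y := by
  have hf : f ∈ Algebra.adjoin F⟮x⟯ {y} := by
    rw [← adjoin_simple_toSubalgebra_of_isAlgebraic h.isIntegral.isAlgebraic,
      h.adjoin_adjoin_eq_top]
    trivial
  induction hf using Algebra.adjoin_induction with
  | mem z hz => exact ⟨0, 1, by rw [Set.mem_singleton_iff.1 hz]; simp⟩
  | algebraMap r => exact ⟨r, 0, by simp⟩
  | add z w _ _ hz hw =>
    obtain ⟨u, v, rfl⟩ := hz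
    obtain ⟨u', v', rfl⟩ := hw
    exact ⟨u + u', v + v', by push_cast; ring⟩
  | mul z w _ _ hz hw =>
    obtain ⟨u, v, rfl⟩ := hz
    obtain ⟨u', v', rfl⟩ := hw
    exact ⟨u * u' + v * v' * ⟨y ^ 2, h.sq_mem⟩, u * v' + v * u', by push_cast; ring⟩

end IsEdwardsPair

/-! ### Functions with at most one simple pole -/

namespace WithZero

theorem le_exp_neg_one_of_lt_one {a : ℤᵐ⁰} (h : a < 1) : a ≤ WithZero.exp (-1) := by
  rcases eq_or_ne a 0 with rfl | ha
  · exact zero_le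
  rw [← WithZero.exp_log ha, ← WithZero.exp_zero, WithZero.exp_lt_exp] at h
  rw [← WithZero.exp_log ha, WithZero.exp_le_exp]
  omega

theorem mul_le_one_of_lt_one {a b : ℤᵐ⁰} (ha : a < 1) (hb : b ≤ WithZero.exp 1) : a * b ≤ 1 := by
  calc a * b ≤ WithZero.exp (-1) * WithZero.exp 1 :=
        mul_le_mul' (le_exp_neg_one_of_lt_one ha) hb
    _ = 1 := by rw [← WithZero.exp_add]; simp

end WithZero

namespace Place
variable {F M : Type*} [Field F] [Field M] [Algebra F M]

theorem val_algebraMap_le_one (v : Place F M) (c : F) : v.val (algebraMap F M c) ≤ 1 := by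
  rcases eq_or_ne c 0 with rfl | hc
  · simp
  · exact (v.val_algebraMap c hc).le

end Place

namespace IsEdwardsPair
variable {F M : Type*} [Field F] [Field M] [Algebra F M] {d : F} {x y : M}
open IntermediateField
open scoped IntermediateField.algebraAdjoinAdjoin

/-- Trace and norm to `F(x)` of a function which is regular wherever the generator `t` of `F(x)`
is finite. -/
theorem trace_norm_mem_adjoin (h : IsEdwardsPair d x y) {t U V : M} (ht : Transcendental F t)
    (htx : F⟮t⟯ = F⟮x⟯) (hU : U ∈ F⟮x⟯) (hV : V ∈ F⟮x⟯)
    (hv : ∀ v : Place F M, v.val t ≤ 1 → v.val (U + V * y) ≤ 1) :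
    2 * U ∈ Algebra.adjoin F {t} ∧ U ^ 2 - V ^ 2 * y ^ 2 ∈ Algebra.adjoin F {t} := by
  have hfd := h.finiteDimensional
  have hsep := h.isSeparable
  have hy := h.notMem
  have hy2 := h.sq_mem
  rw [← htx] at hfd hsep hy hy2 hU hV
  have hint := isIntegral_of_forall_place_le_one ht hv
  have := isPrincipalIdealRing_adjoin_singleton ht
  obtain ⟨⟨u, hu⟩, ⟨w, hw⟩⟩ := mem_range_of_isIntegral_add_mul_sqrt
    (A := Algebra.adjoin F {t}) (c := (⟨y ^ 2, hy2⟩ : F⟮t⟯)) (U := ⟨U, hU⟩) (V := ⟨V, hV⟩)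
    (y := y) rfl (fun ⟨z, hz⟩ ↦ hy (hz ▸ z.2)) hint
  have hu' : (u : M) = 2 * U := congrArg (algebraMap F⟮t⟯ M) hu
  have hw' : (w : M) = U ^ 2 - V ^ 2 * y ^ 2 := congrArg (algebraMap F⟮t⟯ M) hw
  exact ⟨hu' ▸ u.2, hw' ▸ w.2⟩

/-- A function whose only poles are at most simple and located at the zeros of `x - a` has the form
`(α + β x) / (x - a)`. -/
theorem exists_sub_mul_eq (h : IsEdwardsPair d x y) {a : F} {f : M}
    (hf : ∀ v : Place F M, v.val f ≤ 1 ∨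
      (v.val f ≤ WithZero.exp 1 ∧ v.val (x - algebraMap F M a) < 1)) :
    ∃ α β : F, (x - algebraMap F M a) * f = algebraMap F M α + algebraMap F M β * x := by
  have hx0 : x ≠ 0 := fun h0 ↦ h.transcendental (h0 ▸ isAlgebraic_zero)
  have hxK := mem_adjoin_simple_self F x
  obtain ⟨⟨u, hu⟩, ⟨v, hv⟩, rfl⟩ := h.exists_eq_add_mul f
  set s := x - algebraMap F M a with hs
  have hsK : s ∈ F⟮x⟯ := sub_mem hxK (IntermediateField.algebraMap_mem _ _)
  have hfs : s * (u + v * y) = s * u + s * v * y := by ring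
  have hxinv : F⟮x⁻¹⟯ = F⟮x⟯ := by
    apply le_antisymm <;> rw [adjoin_simple_le_iff]
    · exact inv_mem hxK
    · have := inv_mem (mem_adjoin_simple_self F x⁻¹)
      rwa [inv_inv] at this
  have hsv (w : Place F M) : w.val s ≤ max (w.val x) 1 :=
    (w.val.map_sub _ _).trans (max_le_max le_rfl (w.val_algebraMap_le_one a))
  -- `(x - a) f` is regular where `x` is finite, and `(x - a) f / x` is regular where `1 / x` is.
  obtain ⟨htr, hnm⟩ := h.trace_norm_mem_adjoin h.transcendental rfl (mul_mem hsK hu)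
    (mul_mem hsK hv) fun w hw ↦ by
      rw [← hfs, map_mul]
      rcases hf w with hw' | ⟨hw', hw''⟩
      · exact mul_le_one' ((hsv w).trans (max_le hw le_rfl)) hw'
      · exact WithZero.mul_le_one_of_lt_one hw'' hw'
  obtain ⟨htr', hnm'⟩ := h.trace_norm_mem_adjoin (t := x⁻¹) (U := s * u * x⁻¹) (V := s * v * x⁻¹)
    (fun h' ↦ h.transcendental (by simpa using h'.inv)) hxinv
    (mul_mem (mul_mem hsK hu) (inv_mem hxK)) (mul_mem (mul_mem hsK hv) (inv_mem hxK))
    fun w hw ↦ by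
      have hx1 : 1 ≤ w.val x := by
        rwa [map_inv₀, inv_le_one₀ (zero_lt_iff.2 ((Valuation.ne_zero_iff _).2 hx0))] at hw
      have : s * u * x⁻¹ + s * v * x⁻¹ * y = s * (u + v * y) * x⁻¹ := by ring
      rw [this, map_mul, map_mul]
      rcases hf w with hw' | ⟨hw', hw''⟩
      · calc w.val s * w.val (u + v * y) * w.val x⁻¹ ≤ w.val x * 1 * w.val x⁻¹ := by
              gcongr
              exact (hsv w).trans (max_le le_rfl hx1)
          _ = 1 := by rw [mul_one, ← map_mul, mul_inv_cancel₀ hx0, map_one]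
      · exact mul_le_one' (WithZero.mul_le_one_of_lt_one hw'' hw') hw
  obtain ⟨p, hp, hp'⟩ := exists_natDegree_le_of_mem_adjoin_inv h.transcendental 1 htr (by
    convert htr' using 1; ring)
  obtain ⟨n, hn, hn'⟩ := exists_natDegree_le_of_mem_adjoin_inv h.transcendental 2 hnm (by
    convert hnm' using 1; ring)
  have h2 : (algebraMap F M (1 / 2)) * 2 = 1 := by
    rw [← map_ofNat (algebraMap F M) 2, ← map_mul, one_div, inv_mul_cancel₀ h.two_ne_zero, map_one]
  have hU : s * u = aeval x (C (1 / 2) * p) := by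
    rw [map_mul, aeval_C, ← hp']
    linear_combination (-(s * u)) * h2
  have hV : s * v = 0 := by
    refine eq_zero_of_mem_adjoin_of_sq_mul_eq h.two_ne_zero h.d_ne_zero h.d_ne_one
      h.transcendental (mul_mem hsK hv) (q := (C (1 / 2) * p) ^ 2 - n) ?_ ?_
    · refine (natDegree_sub_le _ _).trans (max_le ?_ hn)
      refine natDegree_pow_le.trans ?_
      have := (natDegree_C_mul_le (1 / 2) p).trans hp
      omega
    · rw [map_sub, map_pow, ← hU, ← hn', ← h.sq_mul_eq]
      ring
  obtain ⟨β, α, hαβ⟩ := exists_eq_X_add_C_of_natDegree_le_one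
    ((natDegree_C_mul_le (1 / 2) p).trans hp)
  refine ⟨α, β, ?_⟩
  rw [hfs, hV, hU, hαβ]
  simp only [map_add, map_mul, aeval_C, aeval_X]
  ring

/-- The curve has positive genus: a function with at most one pole, and this a simple pole,
is constant. Such a function has the forms `(α + β x) / (x - a)` and `(γ + δ y) / (y - b)`, and
comparing the two gives a relation between `x` and `y` that is linear in `y`. -/
theorem exists_eq_algebraMap (h : IsEdwardsPair d x y) {a b : F} {f : M}
    (hf : ∀ v : Place F M, v.val f ≤ 1 ∨ (v.val f ≤ WithZero.exp 1 ∧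
      v.val (x - algebraMap F M a) < 1 ∧ v.val (y - algebraMap F M b) < 1)) :
    ∃ c : F, f = algebraMap F M c := by
  obtain ⟨α, β, hx⟩ := h.exists_sub_mul_eq fun v ↦ (hf v).imp_right fun h ↦ ⟨h.1, h.2.1⟩
  obtain ⟨γ, δ, hy⟩ := h.symm.exists_sub_mul_eq fun v ↦ (hf v).imp_right fun h ↦ ⟨h.1, h.2.2⟩
  have hxK := mem_adjoin_simple_self F x
  have hc (c : F) : algebraMap F M c ∈ F⟮x⟯ := IntermediateField.algebraMap_mem _ _
  have hs : x - algebraMap F M a ≠ 0 := fun h0 ↦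
    h.transcendental (sub_eq_zero.1 h0 ▸ isAlgebraic_algebraMap a)
  set p := algebraMap F M α + algebraMap F M β * x - algebraMap F M δ * (x - algebraMap F M a)
    with hp
  have hpK : p ∈ F⟮x⟯ := sub_mem (add_mem (hc _) (mul_mem (hc _) hxK))
    (mul_mem (hc _) (sub_mem hxK (hc _)))
  have hrel : y * p = algebraMap F M b * (algebraMap F M α + algebraMap F M β * x) +
      algebraMap F M γ * (x - algebraMap F M a) := by
    rw [hp]
    linear_combination (x - algebraMap F M a) * hy - (y - algebraMap F M b) * hx
  refine ⟨δ, ?_⟩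
  by_cases hp0 : p = 0
  · apply mul_left_cancel₀ hs
    linear_combination hx + hp0 + hp
  · refine absurd ?_ h.notMem
    rw [← eq_div_iff hp0] at hrel
    rw [hrel]
    exact div_mem (add_mem (mul_mem (hc _) (add_mem (hc _) (mul_mem (hc _) hxK)))
      (mul_mem (hc _) (sub_mem hxK (hc _)))) hpK

end IsEdwardsPair

/-! ### Uniformizers and places over a point -/

section LocalStructure
variable {F M : Type*} [Field F] [Field M] [Algebra F M] {x y : M} {a b : F}

/-- The place `v` lies over the point `(a, b)` with respect to the coordinate functions `x`, `y`. -/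
def Place.IsOver (v : Place F M) (x y : M) (a b : F) : Prop :=
  v.val (x - algebraMap F M a) < 1 ∧ v.val (y - algebraMap F M b) < 1

/-- The function `u` takes a nonzero value `c` in the base field at the point `(a, b)`. -/
def IsUnitAt (x y : M) (a b : F) (u : M) : Prop :=
  ∃ c : F, c ≠ 0 ∧ ∀ v : Place F M, v.IsOver x y a b → v.val (u - algebraMap F M c) < 1

/-- The function `t` vanishes at `(a, b)` and generates the maximal ideal of the local ring at
`(a, b)`, in the sense that `x - a` and `y - b` are multiples of `t` up to a unit `e`. -/
def IsUniformizerAt (x y : M) (a b : F) (t : M) : Prop :=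
  (∀ v : Place F M, v.IsOver x y a b → v.val t < 1) ∧
    ∃ e, IsUnitAt x y a b e ∧
      (∃ g ∈ Algebra.adjoin F {x, y}, e * (x - algebraMap F M a) = t * g) ∧
      ∃ g ∈ Algebra.adjoin F {x, y}, e * (y - algebraMap F M b) = t * g

theorem IsUnitAt.symm {u : M} (h : IsUnitAt y x b a u) : IsUnitAt x y a b u :=
  let ⟨c, hc, h⟩ := h
  ⟨c, hc, fun v hv ↦ h v hv.symm⟩

theorem IsUniformizerAt.symm {t : M} (h : IsUniformizerAt y x b a t) :
    IsUniformizerAt x y a b t := by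
  obtain ⟨ht, e, he, hx, hy⟩ := h
  rw [Set.pair_comm] at hx hy
  exact ⟨fun v hv ↦ ht v hv.symm, e, he.symm, hy, hx⟩

namespace Place

/-- A function congruent to a nonzero constant is a unit. -/
theorem val_eq_one_of_sub_lt_one (v : Place F M) {f : M} {c : F} (hc : c ≠ 0)
    (h : v.val (f - algebraMap F M c) < 1) : v.val f = 1 := by
  rw [← v.val_algebraMap c hc] at h ⊢
  have := v.val.map_add_eq_of_lt_left h
  rwa [add_comm, sub_add_cancel] at this

theorem IsOver.val_le_one {v : Place F M} (hv : v.IsOver x y a b) {f : M}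
    (hf : f ∈ Algebra.adjoin F {x, y}) : v.val f ≤ 1 := by
  have key {z : M} {c : F} (hz : v.val (z - algebraMap F M c) < 1) : v.val z ≤ 1 := by
    rw [← sub_add_cancel z (algebraMap F M c)]
    exact v.val.map_add_le hz.le (v.val_algebraMap_le_one c)
  induction hf using Algebra.adjoin_induction with
  | mem z hz =>
    rcases hz with rfl | rfl
    exacts [key hv.1, key hv.2]
  | algebraMap r => exact v.val_algebraMap_le_one r
  | add z w _ _ hz hw => exact v.val.map_add_le hz hw
  | mul z w _ _ hz hw => rw [map_mul]; exact mul_le_one' hz hw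

end Place

namespace IsUnitAt

theorem val_eq_one {u : M} (hu : IsUnitAt x y a b u) {v : Place F M} (hv : v.IsOver x y a b) :
    v.val u = 1 :=
  let ⟨_, hc, h⟩ := hu
  v.val_eq_one_of_sub_lt_one hc (h v hv)

theorem mul {u w : M} (hu : IsUnitAt x y a b u) (hw : IsUnitAt x y a b w) :
    IsUnitAt x y a b (u * w) := by
  have hu' := hu
  obtain ⟨c, hc, hu⟩ := hu
  obtain ⟨c', hc', hw⟩ := hw
  refine ⟨c * c', mul_ne_zero hc hc', fun v hv ↦ ?_⟩
  have : u * w - algebraMap F M (c * c') =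
      u * (w - algebraMap F M c') + algebraMap F M c' * (u - algebraMap F M c) := by
    rw [map_mul]; ring
  rw [this]
  refine v.val.map_add_lt ?_ ?_
  · rw [map_mul, hu'.val_eq_one hv, one_mul]; exact hw v hv
  · rw [map_mul, v.val_algebraMap c' hc', one_mul]; exact hu v hv

theorem inv {u : M} (hu : IsUnitAt x y a b u) : IsUnitAt x y a b u⁻¹ := by
  have hu' := hu
  obtain ⟨c, hc, hu⟩ := hu
  refine ⟨c⁻¹, inv_ne_zero hc, fun v hv ↦ ?_⟩
  have hu1 := hu'.val_eq_one hv
  have hu0 : u ≠ 0 := fun h0 ↦ by simp [h0] at hu1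
  have hc0 : algebraMap F M c ≠ 0 := (_root_.map_ne_zero _).2 hc
  have : u⁻¹ - algebraMap F M c⁻¹ = -(u - algebraMap F M c) * (u⁻¹ * (algebraMap F M c)⁻¹) := by
    rw [map_inv₀]; field_simp; ring
  rw [this, map_mul, map_mul, map_inv₀, map_inv₀, hu1, v.val_algebraMap c hc, Valuation.map_neg]
  simpa using hu v hv

end IsUnitAt

theorem exists_eq_add_of_mem_adjoin (a b : F) {p : M} (hp : p ∈ Algebra.adjoin F {x, y}) :
    ∃ c : F, ∃ α ∈ Algebra.adjoin F {x, y}, ∃ β ∈ Algebra.adjoin F {x, y},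
      p = algebraMap F M c + α * (x - algebraMap F M a) + β * (y - algebraMap F M b) := by
  induction hp using Algebra.adjoin_induction with
  | mem z hz =>
    rcases hz with rfl | rfl
    · exact ⟨a, 1, one_mem _, 0, zero_mem _, by ring⟩
    · exact ⟨b, 0, zero_mem _, 1, one_mem _, by ring⟩
  | algebraMap r => exact ⟨r, 0, zero_mem _, 0, zero_mem _, by ring⟩
  | add z w _ _ hz hw =>
    obtain ⟨c, α, hα, β, hβ, rfl⟩ := hz
    obtain ⟨c', α', hα', β', hβ', rfl⟩ := hw
    exact ⟨c + c', α + α', add_mem hα hα', β + β', add_mem hβ hβ', by rw [map_add]; ring⟩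
  | mul z w _ hw' hz hw =>
    obtain ⟨c, α, hα, β, hβ, rfl⟩ := hz
    obtain ⟨c', α', hα', β', hβ', hw⟩ := hw
    refine ⟨c * c', algebraMap F M c * α' + α * w,
      add_mem (mul_mem (algebraMap_mem _ _) hα') (mul_mem hα hw'),
      algebraMap F M c * β' + β * w, add_mem (mul_mem (algebraMap_mem _ _) hβ') (mul_mem hβ hw'),
      ?_⟩
    rw [map_mul]
    linear_combination algebraMap F M c * hw

/-- A polynomial in `x` and `y` is a unit at `(a, b)` unless it lies in the ideal
`(x - a, y - b)`. -/
theorem isUnitAt_or_eq_add_of_mem_adjoin (a b : F) {p : M} (hp : p ∈ Algebra.adjoin F {x, y}) :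
    IsUnitAt x y a b p ∨ ∃ α ∈ Algebra.adjoin F {x, y}, ∃ β ∈ Algebra.adjoin F {x, y},
      p = α * (x - algebraMap F M a) + β * (y - algebraMap F M b) := by
  obtain ⟨c, α, hα, β, hβ, rfl⟩ := exists_eq_add_of_mem_adjoin a b hp
  rcases eq_or_ne c 0 with rfl | hc
  · exact Or.inr ⟨α, hα, β, hβ, by rw [map_zero, zero_add]⟩
  refine Or.inl ⟨c, hc, fun v hv ↦ ?_⟩
  rw [add_assoc, add_sub_cancel_left]
  refine v.val.map_add_lt ?_ ?_ <;> rw [map_mul]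
  exacts [mul_lt_one_of_nonneg_of_lt_one_right (hv.val_le_one hα) zero_le hv.1,
    mul_lt_one_of_nonneg_of_lt_one_right (hv.val_le_one hβ) zero_le hv.2]

namespace IsUniformizerAt
variable {t : M}

/-- Factorisation in the local ring at `(a, b)`. The order of vanishing of `p` at a given place
bounds the number of factors `t` that can be split off. -/
theorem exists_eq_pow_mul_of_mem_adjoin (ht : IsUniformizerAt x y a b t) {v : Place F M}
    (hv : v.IsOver x y a b) (N : ℕ) {p : M} (hp : p ∈ Algebra.adjoin F {x, y})
    (hN : WithZero.exp (-(N : ℤ)) ≤ v.val p) :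
    ∃ (n : ℕ) (u : M), IsUnitAt x y a b u ∧ p = t ^ n * u := by
  obtain ⟨htv, e, he, ⟨g₁, hg₁, hx⟩, ⟨g₂, hg₂, hy⟩⟩ := id ht
  induction N generalizing p with
  | zero =>
    rcases isUnitAt_or_eq_add_of_mem_adjoin a b hp with hu | ⟨α, hα, β, hβ, rfl⟩
    · exact ⟨0, p, hu, by simp⟩
    refine absurd (v.val.map_add_lt (g := 1) ?_ ?_) (not_lt.2 (by simpa using hN)) <;> rw [map_mul]
    exacts [mul_lt_one_of_nonneg_of_lt_one_right (hv.val_le_one hα) zero_le hv.1,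
      mul_lt_one_of_nonneg_of_lt_one_right (hv.val_le_one hβ) zero_le hv.2]
  | succ N ih =>
    rcases isUnitAt_or_eq_add_of_mem_adjoin a b hp with hu | ⟨α, hα, β, hβ, hpc⟩
    · exact ⟨0, p, hu, by simp⟩
    have hep : e * p = t * (α * g₁ + β * g₂) := by
      rw [hpc]
      linear_combination α * hx + β * hy
    have hval := congrArg v.val hep
    rw [map_mul, map_mul, he.val_eq_one hv, one_mul] at hval
    obtain ⟨n, u, hu, hp'⟩ := ih (add_mem (mul_mem hα hg₁) (mul_mem hβ hg₂)) (by
      have h1 := hN.trans (hval.le.trans (mul_le_mul_left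
        (WithZero.le_exp_neg_one_of_lt_one (htv v hv)) _))
      have h2 := mul_le_mul_right h1 (WithZero.exp 1)
      rw [← mul_assoc, ← WithZero.exp_add, ← WithZero.exp_add] at h2
      simpa using h2)
    refine ⟨n + 1, u * e⁻¹, hu.mul he.inv, ?_⟩
    have he0 : e ≠ 0 := fun h0 ↦ by simpa [h0] using he.val_eq_one hv
    rw [hp'] at hep
    field_simp
    linear_combination hep

theorem exists_eq_zpow_mul (ht : IsUniformizerAt x y a b t)
    (htop : IntermediateField.adjoin F {x, y} = ⊤) {v : Place F M} (hv : v.IsOver x y a b)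
    {f : M} (hf : f ≠ 0) (ht0 : t ≠ 0) :
    ∃ (n : ℤ) (u : M), IsUnitAt x y a b u ∧ f = t ^ n * u := by
  have hmem : f ∈ IntermediateField.adjoin F {x, y} := htop ▸ trivial
  obtain ⟨p, hp, q, hq, rfl⟩ := IntermediateField.mem_adjoin_iff_div.1 hmem
  have key {p : M} (hp : p ∈ Algebra.adjoin F {x, y}) (hp0 : p ≠ 0) :
      ∃ (n : ℕ) (u : M), IsUnitAt x y a b u ∧ p = t ^ n * u := by
    refine ht.exists_eq_pow_mul_of_mem_adjoin hv (WithZero.log (v.val p)).natAbs hp ?_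
    rw [← WithZero.le_log_iff_exp_le ((Valuation.ne_zero_iff _).2 hp0)]
    omega
  obtain ⟨n, u, hu, rfl⟩ := key hp fun h0 ↦ hf (by rw [h0, zero_div])
  obtain ⟨m, w, hw, rfl⟩ := key hq fun h0 ↦ hf (by rw [h0, div_zero])
  refine ⟨n - m, u * w⁻¹, hu.mul hw.inv, ?_⟩
  rw [zpow_sub₀ ht0, zpow_natCast, zpow_natCast]
  field_simp

theorem val_eq_exp (ht : IsUniformizerAt x y a b t)
    (htop : IntermediateField.adjoin F {x, y} = ⊤) {v : Place F M} (hv : v.IsOver x y a b)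
    (ht0 : t ≠ 0) : v.val t = WithZero.exp (-1) := by
  have hvt : v.val t ≠ 0 := (Valuation.ne_zero_iff _).2 ht0
  obtain ⟨f, hf⟩ := v.surjective (WithZero.exp (-1))
  obtain ⟨n, u, hu, rfl⟩ := ht.exists_eq_zpow_mul htop hv (f := f) (by
    rintro rfl
    rw [map_zero] at hf
    exact WithZero.exp_ne_zero hf.symm) ht0
  rw [map_mul, hu.val_eq_one hv, mul_one, map_zpow₀] at hf
  have hlt := ht.1 v hv
  rw [← WithZero.exp_log hvt] at hf hlt ⊢
  rw [← WithZero.exp_zsmul, WithZero.exp_inj, smul_eq_mul] at hf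
  rw [← WithZero.exp_zero, WithZero.exp_lt_exp] at hlt
  rw [WithZero.exp_inj]
  have hdvd : WithZero.log (v.val t) ∣ 1 := ⟨-n, by linear_combination hf⟩
  have := Int.natAbs_dvd_natAbs.2 hdvd
  have := Nat.dvd_one.1 this
  omega

/-- There is only one place over a point with a uniformizer. -/
theorem val_eq_val (ht : IsUniformizerAt x y a b t)
    (htop : IntermediateField.adjoin F {x, y} = ⊤) {v : Place F M} (hv : v.IsOver x y a b)
    (ht0 : t ≠ 0) {w : Place F M} (hw : w.IsOver x y a b) (f : M) :
    v.val f = w.val f := by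
  rcases eq_or_ne f 0 with rfl | hf
  · simp
  obtain ⟨n, u, hu, rfl⟩ := ht.exists_eq_zpow_mul htop hv hf ht0
  rw [map_mul, map_mul, map_zpow₀, map_zpow₀, hu.val_eq_one hv, hu.val_eq_one hw,
    ht.val_eq_exp htop hv ht0, ht.val_eq_exp htop hw ht0]

/-- The residue field at a point with a uniformizer is the base field. -/
theorem exists_val_sub_lt_one (ht : IsUniformizerAt x y a b t)
    (htop : IntermediateField.adjoin F {x, y} = ⊤) {v : Place F M} (hv : v.IsOver x y a b)
    (ht0 : t ≠ 0) {f : M} (hf : v.val f ≤ 1) :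
    ∃ c : F, v.val (f - algebraMap F M c) < 1 := by
  rcases eq_or_ne f 0 with rfl | hf0
  · exact ⟨0, by simp⟩
  obtain ⟨n, u, hu, rfl⟩ := ht.exists_eq_zpow_mul htop hv hf0 ht0
  rcases eq_or_ne n 0 with rfl | hn
  · obtain ⟨c, -, hc⟩ := hu
    exact ⟨c, by simpa using hc v hv⟩
  refine ⟨0, ?_⟩
  rw [map_zero, sub_zero]
  rw [map_mul, map_zpow₀, hu.val_eq_one hv, ht.val_eq_exp htop hv ht0, mul_one,
    ← WithZero.exp_zsmul, ← WithZero.exp_zero] at hf ⊢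
  rw [WithZero.exp_le_exp, smul_eq_mul] at hf
  rw [WithZero.exp_lt_exp, smul_eq_mul]
  omega

end IsUniformizerAt
end LocalStructure

namespace IsEdwardsPair
variable {F M : Type*} [Field F] [Field M] [Algebra F M] {d : F} {x y : M} {a b : F}

theorem one_sub_mul_sq_ne_zero (h : IsEdwardsPair d x y)
    (hab : a ^ 2 + b ^ 2 = 1 + d * a ^ 2 * b ^ 2) : 1 - d * a ^ 2 ≠ 0 := by
  intro h0
  have h1 : 1 - a ^ 2 = 0 := by linear_combination b ^ 2 * h0 - hab
  exact h.d_ne_one (by linear_combination d * h1 - h0)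

theorem sub_algebraMap_ne_zero (h : IsEdwardsPair d x y) (a : F) : x - algebraMap F M a ≠ 0 :=
  fun h0 ↦ h.transcendental (sub_eq_zero.1 h0 ▸ isAlgebraic_algebraMap a)

/-- At a point with `b ≠ 0` the tangent is not vertical, so `x - a` is a uniformizer:
`(y - b) (y + b) (1 - d x²) = (x - a) (x + a) (d b² - 1)`. -/
theorem isUniformizerAt_sub (h : IsEdwardsPair d x y)
    (hab : a ^ 2 + b ^ 2 = 1 + d * a ^ 2 * b ^ 2) (hb : b ≠ 0) :
    IsUniformizerAt x y a b (x - algebraMap F M a) := by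
  have hx : x ∈ Algebra.adjoin F {x, y} := Algebra.subset_adjoin (Set.mem_insert _ _)
  have hy : y ∈ Algebra.adjoin F {x, y} := Algebra.subset_adjoin (Set.mem_insert_of_mem _ rfl)
  have hc (c : F) : algebraMap F M c ∈ Algebra.adjoin F {x, y} := algebraMap_mem _ c
  have he : (y + algebraMap F M b) * (1 - algebraMap F M d * x ^ 2) ∈ Algebra.adjoin F {x, y} :=
    mul_mem (add_mem hy (hc _)) (sub_mem (one_mem _) (mul_mem (hc _) (pow_mem hx 2)))
  refine ⟨fun v hv ↦ hv.1, _, ⟨2 * b * (1 - d * a ^ 2), ?_, fun v hv ↦ ?_⟩, ⟨_, he, mul_comm _ _⟩,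
    (x + algebraMap F M a) * (algebraMap F M (d * b ^ 2 - 1)),
    mul_mem (add_mem hx (hc _)) (hc _), ?_⟩
  · exact mul_ne_zero (mul_ne_zero h.two_ne_zero hb) (h.one_sub_mul_sq_ne_zero hab)
  · have : (y + algebraMap F M b) * (1 - algebraMap F M d * x ^ 2) -
        algebraMap F M (2 * b * (1 - d * a ^ 2)) =
        (1 - algebraMap F M d * x ^ 2) * (y - algebraMap F M b) +
        (-algebraMap F M (2 * b * d) * (x + algebraMap F M a)) * (x - algebraMap F M a) := by
      simp only [map_mul, map_sub, map_one, map_pow, map_ofNat]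
      ring
    rw [this]
    refine v.val.map_add_lt ?_ ?_ <;> rw [map_mul]
    · exact mul_lt_one_of_nonneg_of_lt_one_right (hv.val_le_one
        (sub_mem (one_mem _) (mul_mem (hc _) (pow_mem hx 2)))) zero_le hv.2
    · exact mul_lt_one_of_nonneg_of_lt_one_right (hv.val_le_one
        (mul_mem (neg_mem (hc _)) (add_mem hx (hc _)))) zero_le hv.1
  · have hab' := congrArg (algebraMap F M) hab
    simp only [map_add, map_mul, map_sub, map_one, map_pow] at hab' ⊢
    linear_combination h.equation - hab'

end IsEdwardsPair

/-! ### Zeros of the coordinate functions -/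

namespace Place
variable {F M : Type*} [Field F] [Field M] [Algebra F M] (v : Place F M) {f : M} {a c : F}

theorem val_sub_eq_one_of_ne (h : v.val (f - algebraMap F M a) < 1) (hac : a ≠ c) :
    v.val (f - algebraMap F M c) = 1 := by
  refine v.val_eq_one_of_sub_lt_one (sub_ne_zero.2 hac) ?_
  rwa [map_sub (algebraMap F M), sub_sub_sub_cancel_right]

theorem val_sub_le_of_one_le (h : 1 ≤ v.val (f - algebraMap F M a)) :
    v.val (f - algebraMap F M c) ≤ v.val (f - algebraMap F M a) := by
  have : f - algebraMap F M c = f - algebraMap F M a + algebraMap F M (a - c) := by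
    rw [map_sub]; ring
  rw [this]
  exact v.val.map_add_le le_rfl ((v.val_algebraMap_le_one _).trans h)

theorem val_le_one_of_sub_lt_one (h : v.val (f - algebraMap F M a) < 1) : v.val f ≤ 1 := by
  rw [← sub_add_cancel f (algebraMap F M a)]
  exact v.val.map_add_le h.le (v.val_algebraMap_le_one a)

theorem val_sub_lt_one_or (h : v.val ((f - algebraMap F M a) * (f - algebraMap F M c)) < 1) :
    v.val (f - algebraMap F M a) < 1 ∨ v.val (f - algebraMap F M c) < 1 := by
  by_contra! h'
  rw [map_mul] at h
  exact absurd h (not_lt.2 (one_le_mul h'.1 h'.2))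

end Place

namespace IsEdwardsPair
variable {F M : Type*} [Field F] [Field M] [Algebra F M] {d : F} {x y : M} {a b c : F}
  {v : Place F M}

theorem val_one_sub_eq_one (h : IsEdwardsPair d x y) (hab : a ^ 2 + b ^ 2 = 1 + d * a ^ 2 * b ^ 2)
    (hv : v.val (x - algebraMap F M a) < 1) : v.val (1 - algebraMap F M d * x ^ 2) = 1 := by
  refine v.val_eq_one_of_sub_lt_one (h.one_sub_mul_sq_ne_zero hab) ?_
  have : 1 - algebraMap F M d * x ^ 2 - algebraMap F M (1 - d * a ^ 2) =
      (x - algebraMap F M a) * (algebraMap F M (-d) * (x - algebraMap F M (-a))) := by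
    simp only [map_sub, map_mul, map_one, map_pow, map_neg]; ring
  rw [this, map_mul, map_mul]
  refine mul_lt_one_of_lt_of_le hv (mul_le_one' (v.val_algebraMap_le_one _) ?_)
  exact (v.val.map_sub _ _).trans
    (max_le (v.val_le_one_of_sub_lt_one hv) (v.val_algebraMap_le_one _))

theorem sub_mul_sub_eq (h : IsEdwardsPair d x y) (hab : a ^ 2 + b ^ 2 = 1 + d * a ^ 2 * b ^ 2) :
    (y - algebraMap F M b) * (y - algebraMap F M (-b)) * (1 - algebraMap F M d * x ^ 2) =
      (x - algebraMap F M a) * ((x - algebraMap F M (-a)) * algebraMap F M (d * b ^ 2 - 1)) := by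
  have hab' := congrArg (algebraMap F M) hab
  simp only [map_add, map_mul, map_sub, map_one, map_pow, map_neg] at hab' ⊢
  linear_combination h.equation - hab'

/-- Where `x` takes the value `a`, the function `y` takes one of the values `b` and `-b`. -/
theorem val_mul_le (h : IsEdwardsPair d x y) (hab : a ^ 2 + b ^ 2 = 1 + d * a ^ 2 * b ^ 2)
    (hv : v.val (x - algebraMap F M a) < 1) :
    v.val ((y - algebraMap F M b) * (y - algebraMap F M (-b))) ≤ v.val (x - algebraMap F M a) := by
  have := congrArg v.val (h.sub_mul_sub_eq hab)
  rw [map_mul, h.val_one_sub_eq_one hab hv, mul_one] at this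
  rw [this, map_mul]
  refine mul_le_of_le_one_right' ?_
  rw [map_mul]
  refine mul_le_one' ((v.val.map_sub _ _).trans
    (max_le (v.val_le_one_of_sub_lt_one hv) (v.val_algebraMap_le_one _)))
    (v.val_algebraMap_le_one _)

theorem val_sub_eq_exp (h : IsEdwardsPair d x y) (hab : a ^ 2 + b ^ 2 = 1 + d * a ^ 2 * b ^ 2)
    (hb : b ≠ 0) (hv : v.IsOver x y a b) : v.val (x - algebraMap F M a) = WithZero.exp (-1) :=
  (h.isUniformizerAt_sub hab hb).val_eq_exp h.adjoin_eq_top hv (h.sub_algebraMap_ne_zero a)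

/-- The function `y - c`, with `c = ±1`, has a double zero at `(0, c)` and no other zeros. -/
theorem of_val_sub_lt_one (h : IsEdwardsPair d x y) (hc : c ^ 2 = 1)
    (hv : v.val (y - algebraMap F M c) < 1) :
    v.IsOver x y 0 c ∧ v.val x = WithZero.exp (-1) ∧
      v.val (y - algebraMap F M c) = WithZero.exp (-2) := by
  have hc0 : c ≠ 0 := by rintro rfl; simp at hc
  have h0c : (0 : F) ^ 2 + c ^ 2 = 1 + d * 0 ^ 2 * c ^ 2 := by rw [hc]; ring
  have hc0' : c ^ 2 + (0 : F) ^ 2 = 1 + d * c ^ 2 * 0 ^ 2 := by rw [hc]; ring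
  have hneg : v.val (y - algebraMap F M (-c)) = 1 := by
    refine v.val_sub_eq_one_of_ne hv fun h' ↦ ?_
    exact mul_ne_zero h.two_ne_zero hc0 (by linear_combination h')
  have heq : v.val x ^ 2 = v.val (y - algebraMap F M c) := by
    have heq : x ^ 2 * (1 - algebraMap F M d * y ^ 2) =
        -((y - algebraMap F M c) * (y - algebraMap F M (-c))) := by
      have hc' := congrArg (algebraMap F M) hc
      rw [map_pow, map_one] at hc'
      rw [map_neg]
      linear_combination h.equation - hc'
    have := congrArg v.val heq
    rwa [Valuation.map_neg, map_mul, map_mul, map_pow, hneg, mul_one,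
      h.symm.val_one_sub_eq_one hc0' hv, mul_one] at this
  have hx : v.val x < 1 := by
    rw [← heq] at hv
    exact lt_of_pow_lt_pow_left₀ 2 zero_le (by simpa using hv)
  have hover : v.IsOver x y 0 c := ⟨by simpa using hx, hv⟩
  have hx' : v.val x = WithZero.exp (-1) := by simpa using h.val_sub_eq_exp h0c hc0 hover
  refine ⟨hover, hx', ?_⟩
  rw [← heq, hx', ← WithZero.exp_nsmul]
  rfl

theorem isOver_of_val_lt_one (h : IsEdwardsPair d x y) (hc : c ^ 2 = 1) (hx : v.val x < 1) :
    v.IsOver x y 0 c ∨ v.IsOver x y 0 (-c) := by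
  have h0c : (0 : F) ^ 2 + c ^ 2 = 1 + d * 0 ^ 2 * c ^ 2 := by rw [hc]; ring
  have hx' : v.val (x - algebraMap F M 0) < 1 := by simpa using hx
  exact (v.val_sub_lt_one_or ((h.val_mul_le h0c hx').trans_lt hx')).imp
    (fun h' ↦ ⟨hx', h'⟩) (fun h' ↦ ⟨hx', h'⟩)

end IsEdwardsPair

/-! ### Poles of the basis functions -/

namespace IsEdwardsPair
variable {F M : Type*} [Field F] [Field M] [Algebra F M] {d : F} {x y : M} {a b c : F}
  {v : Place F M}

theorem one_le_val_sub_one (h : IsEdwardsPair d x y) (hO : ¬ v.IsOver x y 0 1) :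
    1 ≤ v.val (y - 1) := by
  by_contra! hlt
  exact hO (h.of_val_sub_lt_one (one_pow 2) (by rwa [map_one])).1

/-- Orders of vanishing of the functions entering the basis at the place over `(0, 1)`. -/
theorem val_of_isOver_zero_one (h : IsEdwardsPair d x y) (hO : v.IsOver x y 0 1) :
    v.val x = WithZero.exp (-1) ∧ v.val (y - 1) = WithZero.exp (-2) ∧
      v.val (y + 1) = 1 ∧ v.val y = 1 := by
  obtain ⟨-, hx, hy⟩ := h.of_val_sub_lt_one (one_pow 2) hO.2
  rw [map_one] at hy
  refine ⟨hx, hy, ?_, v.val_eq_one_of_sub_lt_one one_ne_zero hO.2⟩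
  have h1 : (1 : F) ≠ -1 := fun h' ↦ h.two_ne_zero (by linear_combination h')
  simpa using v.val_sub_eq_one_of_ne hO.2 h1

theorem val_of_isOver_zero_neg_one (h : IsEdwardsPair d x y) (hO : v.IsOver x y 0 (-1)) :
    v.val x = WithZero.exp (-1) ∧ v.val (y + 1) = WithZero.exp (-2) ∧
      v.val (y - 1) = 1 ∧ v.val y = 1 := by
  obtain ⟨-, hx, hy⟩ := h.of_val_sub_lt_one (c := -1) (by ring) hO.2
  refine ⟨hx, by simpa using hy, ?_,
    v.val_eq_one_of_sub_lt_one (neg_ne_zero.2 one_ne_zero) hO.2⟩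
  have h1 : (-1 : F) ≠ 1 := fun h' ↦ h.two_ne_zero (by linear_combination -h')
  simpa using v.val_sub_eq_one_of_ne hO.2 h1

/-- Pole order of `F₂ₙ = 1 / (y - 1)ⁿ` at `O`. -/
theorem val_one_div_pow (h : IsEdwardsPair d x y) (hO : v.IsOver x y 0 1) (n : ℕ) :
    v.val (1 / (y - 1) ^ n) = WithZero.exp (2 * n : ℤ) := by
  rw [map_div₀, map_one, map_pow, (h.val_of_isOver_zero_one hO).2.1, ← WithZero.exp_nsmul,
    one_div, ← WithZero.exp_neg]
  congr 1
  simp [mul_comm]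

theorem val_one_div_pow_le_one (h : IsEdwardsPair d x y) (hO : ¬ v.IsOver x y 0 1) (n : ℕ) :
    v.val (1 / (y - 1) ^ n) ≤ 1 := by
  rw [map_div₀, map_one, map_pow, one_div]
  exact inv_le_one_of_one_le₀ (one_le_pow₀ (h.one_le_val_sub_one hO))

/-- Pole order of `F₂ₙ₊₁ = (y + 1) / (x (y - 1)ⁿ)` at `O`. -/
theorem val_div_mul_pow (h : IsEdwardsPair d x y) (hO : v.IsOver x y 0 1) (n : ℕ) :
    v.val ((y + 1) / (x * (y - 1) ^ n)) = WithZero.exp (2 * n + 1 : ℤ) := by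
  have : (y + 1) / (x * (y - 1) ^ n) = (y + 1) / x * (1 / (y - 1) ^ n) := by
    rw [div_mul_div_comm, mul_one]
  obtain ⟨hx, -, hy, -⟩ := h.val_of_isOver_zero_one hO
  rw [this, map_mul, h.val_one_div_pow hO, map_div₀, hx, hy, one_div, ← WithZero.exp_neg,
    ← WithZero.exp_add]
  congr 1
  ring

theorem val_div_mul_pow_le_one (h : IsEdwardsPair d x y) (hO : ¬ v.IsOver x y 0 1) {n : ℕ}
    (hn : n ≠ 0) : v.val ((y + 1) / (x * (y - 1) ^ n)) ≤ 1 := by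
  obtain ⟨m, rfl⟩ := Nat.exists_eq_succ_of_ne_zero hn
  have : (y + 1) / (x * (y - 1) ^ (m + 1)) = (y + 1) / (x * (y - 1)) * (1 / (y - 1) ^ m) := by
    rw [div_mul_div_comm, mul_one, mul_assoc, pow_succ']
  rw [this, map_mul]
  refine mul_le_one' ?_ (h.val_one_div_pow_le_one hO m)
  rw [map_div₀, map_mul]
  rcases lt_or_ge (v.val x) 1 with hx | hx
  · have hO' := (h.isOver_of_val_lt_one (one_pow 2) hx).resolve_left hO
    obtain ⟨hx, hy, hy', -⟩ := h.val_of_isOver_zero_neg_one hO'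
    rw [hx, hy, hy', mul_one, ← WithZero.exp_sub, ← WithZero.exp_zero, WithZero.exp_le_exp]
    norm_num
  · have h1 := h.one_le_val_sub_one hO
    refine div_le_one_of_le₀ ?_ zero_le
    have h2 := v.val_sub_le_of_one_le (f := y) (a := 1) (c := -1) (by simpa using h1)
    simp only [map_neg, map_one, sub_neg_eq_add] at h2
    exact h2.trans (le_mul_of_one_le_left' hx)

/-- Pole order at `O` of the function `F₁` attached to `O'`. -/
theorem val_one_div (h : IsEdwardsPair d x y) (hO : v.IsOver x y 0 1) :
    v.val (1 / x) = WithZero.exp 1 := by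
  rw [map_div₀, map_one, (h.val_of_isOver_zero_one hO).1, one_div, ← WithZero.exp_neg, neg_neg]

theorem val_one_div_le (h : IsEdwardsPair d x y) (hO : v.IsOver x y 0 (-1)) :
    v.val (1 / x) ≤ WithZero.exp 1 := by
  rw [map_div₀, map_one, (h.val_of_isOver_zero_neg_one hO).1, one_div, ← WithZero.exp_neg, neg_neg]

theorem val_one_div_le_one (h : IsEdwardsPair d x y) (hO : ¬ v.IsOver x y 0 1)
    (hO' : ¬ v.IsOver x y 0 (-1)) : v.val (1 / x) ≤ 1 := by
  rw [map_div₀, map_one, one_div]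
  refine inv_le_one_of_one_le₀ ?_
  by_contra! hx
  exact (h.isOver_of_val_lt_one (one_pow 2) hx).elim hO hO'

/-- Pole order at `O` of the function `F₁` attached to the point `(c, 0)`, where `c = ±1`. -/
theorem val_mul_div_mul (h : IsEdwardsPair d x y) (hc : c ^ 2 = 1) (hO : v.IsOver x y 0 1) :
    v.val ((x - algebraMap F M (-c)) * (y + 1) / (x * y)) = WithZero.exp 1 := by
  have hc0 : c ≠ 0 := by rintro rfl; simp at hc
  obtain ⟨hx, -, hy, hy'⟩ := h.val_of_isOver_zero_one hO
  have hx' : v.val (x - algebraMap F M (-c)) = 1 :=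
    v.val_sub_eq_one_of_ne hO.1 (neg_ne_zero.2 hc0).symm
  rw [map_div₀, map_mul, map_mul, hx, hy, hy', hx', mul_one, mul_one, one_div, ← WithZero.exp_neg,
    neg_neg]

theorem val_mul_div_mul_le (h : IsEdwardsPair d x y) (hc : c ^ 2 = 1) (hP : v.IsOver x y c 0) :
    v.val ((x - algebraMap F M (-c)) * (y + 1) / (x * y)) ≤ WithZero.exp 1 := by
  have hc0 : c ≠ 0 := by rintro rfl; simp at hc
  obtain ⟨-, hy, -⟩ := h.symm.of_val_sub_lt_one hc hP.1
  have hy' : v.val (y - algebraMap F M (-1)) = 1 :=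
    v.val_sub_eq_one_of_ne hP.2 (neg_ne_zero.2 one_ne_zero).symm
  rw [map_neg, map_one, sub_neg_eq_add] at hy'
  rw [map_div₀, map_mul, map_mul, hy, hy', v.val_eq_one_of_sub_lt_one hc0 hP.1, mul_one, one_mul,
    div_eq_mul_inv, ← WithZero.exp_neg, neg_neg]
  refine mul_le_of_le_one_left' ((v.val.map_sub _ _).trans
    (max_le (v.val_le_one_of_sub_lt_one hP.1) (v.val_algebraMap_le_one _)))

theorem val_mul_div_mul_le_one (h : IsEdwardsPair d x y) (hc : c ^ 2 = 1)
    (hO : ¬ v.IsOver x y 0 1) (hP : ¬ v.IsOver x y c 0) :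
    v.val ((x - algebraMap F M (-c)) * (y + 1) / (x * y)) ≤ 1 := by
  have hc0 : c ≠ 0 := by rintro rfl; simp at hc
  rw [map_div₀, map_mul, map_mul]
  rcases lt_or_ge (v.val x) 1 with hx | hx
  · have hO' := (h.isOver_of_val_lt_one (one_pow 2) hx).resolve_left hO
    have hx' : v.val (x - algebraMap F M (-c)) = 1 :=
      v.val_sub_eq_one_of_ne hO'.1 (neg_ne_zero.2 hc0).symm
    obtain ⟨hx, hy, -, hy'⟩ := h.val_of_isOver_zero_neg_one hO'
    rw [hx, hy, hy', hx', mul_one, one_mul, ← WithZero.exp_sub, ← WithZero.exp_zero,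
      WithZero.exp_le_exp]
    norm_num
  have hy1 (hy : 1 ≤ v.val y) : v.val (y + 1) ≤ v.val y := by
    have := v.val_sub_le_of_one_le (f := y) (a := 0) (c := -1) (by simpa using hy)
    simpa using this
  have hx1 : v.val (x - algebraMap F M (-c)) ≤ v.val x := by
    have := v.val_sub_le_of_one_le (f := x) (a := 0) (c := -c) (by simpa using hx)
    simpa using this
  refine div_le_one_of_le₀ ?_ zero_le
  rcases lt_or_ge (v.val y) 1 with hy | hy
  · have hP' := ((h.symm.isOver_of_val_lt_one hc hy).resolve_left fun h' ↦ hP h'.symm)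
    obtain ⟨-, hy', hx'⟩ := h.symm.of_val_sub_lt_one (c := -c) (by rw [neg_sq, hc]) hP'.2
    rw [hx', hy', v.val_eq_one_of_sub_lt_one (neg_ne_zero.2 hc0) hP'.2, one_mul]
    calc WithZero.exp (-2) * v.val (y + 1) ≤ WithZero.exp (-2) * 1 := by
          gcongr
          exact v.val.map_add_le hy.le (by simp)
      _ ≤ WithZero.exp (-1) := by rw [mul_one, WithZero.exp_le_exp]; norm_num
  · exact mul_le_mul' hx1 (hy1 hy)

theorem sq_ne_one (h : IsEdwardsPair d x y) (hab : a ^ 2 + b ^ 2 = 1 + d * a ^ 2 * b ^ 2)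
    (ha : a ≠ 0) : b ^ 2 ≠ 1 := by
  intro hb
  rw [hb, add_comm, mul_one] at hab
  have : a ^ 2 * (1 - d) = 0 := by linear_combination hab
  exact mul_ne_zero (pow_ne_zero 2 ha) (sub_ne_zero.2 h.d_ne_one.symm) this

/-- Pole order at `O` of the function `F₁` attached to a point `(a, b)` with `a b ≠ 0`. -/
theorem val_mul_div_mul_sub (h : IsEdwardsPair d x y)
    (hab : a ^ 2 + b ^ 2 = 1 + d * a ^ 2 * b ^ 2) (ha : a ≠ 0) (hO : v.IsOver x y 0 1) :
    v.val ((y + algebraMap F M b) * x / ((x - algebraMap F M a) * (y - 1))) = WithZero.exp 1 := by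
  obtain ⟨hx, hy, -, -⟩ := h.val_of_isOver_zero_one hO
  have hb : v.val (y - algebraMap F M (-b)) = 1 :=
    v.val_sub_eq_one_of_ne hO.2 fun h' ↦ h.sq_ne_one hab ha (by rw [← neg_sq, ← h', one_pow])
  rw [map_neg, sub_neg_eq_add] at hb
  rw [map_div₀, map_mul, map_mul, hx, hy, hb, v.val_sub_eq_one_of_ne hO.1 ha.symm, one_mul, one_mul,
    ← WithZero.exp_sub]
  norm_num

theorem val_mul_div_mul_sub_le (h : IsEdwardsPair d x y)
    (hab : a ^ 2 + b ^ 2 = 1 + d * a ^ 2 * b ^ 2) (ha : a ≠ 0) (hb : b ≠ 0)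
    (hP : v.IsOver x y a b) :
    v.val ((y + algebraMap F M b) * x / ((x - algebraMap F M a) * (y - 1))) ≤ WithZero.exp 1 := by
  have hy : v.val (y - algebraMap F M 1) = 1 :=
    v.val_sub_eq_one_of_ne hP.2 fun h' ↦ h.sq_ne_one hab ha (by rw [h', one_pow])
  rw [map_one] at hy
  rw [map_div₀, map_mul, map_mul, h.val_sub_eq_exp hab hb hP, hy, mul_one, div_eq_mul_inv,
    ← WithZero.exp_neg, neg_neg]
  exact mul_le_of_le_one_left' (mul_le_one' (v.val.map_add_le (v.val_le_one_of_sub_lt_one hP.2)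
    (v.val_algebraMap_le_one _)) (v.val_le_one_of_sub_lt_one hP.1))

theorem val_mul_div_mul_sub_le_one (h : IsEdwardsPair d x y)
    (hab : a ^ 2 + b ^ 2 = 1 + d * a ^ 2 * b ^ 2)
    (hO : ¬ v.IsOver x y 0 1) (hP : ¬ v.IsOver x y a b) :
    v.val ((y + algebraMap F M b) * x / ((x - algebraMap F M a) * (y - 1))) ≤ 1 := by
  have hy := h.one_le_val_sub_one hO
  have hneg : v.val (y - algebraMap F M (-b)) = v.val (y + algebraMap F M b) := by
    rw [map_neg, sub_neg_eq_add]
  rw [map_div₀, map_mul, map_mul]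
  refine div_le_one_of_le₀ ?_ zero_le
  rcases lt_or_ge (v.val (x - algebraMap F M a)) 1 with hx | hx
  · -- The zeros of `x - a` are `(a, b)` and `(a, -b)`, and `y + b` vanishes at the latter.
    have hyb : 1 ≤ v.val (y - algebraMap F M b) := not_lt.1 fun h' ↦ hP ⟨hx, h'⟩
    have hle := h.val_mul_le hab hx
    rw [map_mul, hneg] at hle
    exact (mul_le_of_le_one_right' (v.val_le_one_of_sub_lt_one hx)).trans
      (((le_mul_of_one_le_left' hyb).trans hle).trans (le_mul_of_one_le_right' hy))
  · have hxa := v.val_sub_le_of_one_le (c := 0) hx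
    have hyb := v.val_sub_le_of_one_le (f := y) (a := 1) (c := -b) (by rwa [map_one])
    rw [map_zero, sub_zero] at hxa
    rw [hneg, map_one] at hyb
    rw [mul_comm]
    exact mul_le_mul' hxa hyb

end IsEdwardsPair

/-! ### The Riemann-Roch space -/

/-- A filtration whose successive quotients are spanned by the elements `G k`, none of which lies
in the preceding step, has the `G k` as a basis. -/
theorem linearIndependent_and_span_eq_of_filtration {F M : Type*} [Field F] [AddCommGroup M]
    [Module F M] {N : ℕ → Submodule F M} {G : ℕ → M} (hN0 : N 0 = Submodule.span F {G 0})
    (hG0 : G 0 ≠ 0) (hmono : ∀ k, N k ≤ N (k + 1)) (hmem : ∀ k, G (k + 1) ∈ N (k + 1))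
    (hnot : ∀ k, G (k + 1) ∉ N k)
    (hstep : ∀ k, ∀ f ∈ N (k + 1), ∃ c : F, f - c • G (k + 1) ∈ N k) (k : ℕ) :
    LinearIndependent F (fun i : Fin (k + 1) => G i) ∧
      Submodule.span F (Set.range fun i : Fin (k + 1) => G i) = N k := by
  induction k with
  | zero =>
    have : Subsingleton (Fin (0 + 1)) := inferInstanceAs (Subsingleton (Fin 1))
    have hi (i : Fin (0 + 1)) : (i : ℕ) = 0 := by omega
    simp only [hi, Set.range_const, hN0, and_true]
    exact LinearIndependent.of_subsingleton 0 hG0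
  | succ k ih =>
    have hsnoc : (fun i : Fin (k + 1 + 1) => G i) =
        Fin.snoc (α := fun _ => M) (fun i : Fin (k + 1) => G i) (G (k + 1)) := by
      funext i
      refine Fin.lastCases ?_ (fun i => ?_) i <;> simp
    rw [hsnoc, linearIndependent_finSnoc, ih.2, Fin.range_snoc, Submodule.span_insert, ih.2]
    refine ⟨⟨ih.1, hnot k⟩, le_antisymm ?_ fun f hf => ?_⟩
    · rw [sup_le_iff, Submodule.span_singleton_le_iff_mem]
      exact ⟨hmem k, hmono k⟩
    · obtain ⟨c, hc⟩ := hstep k f hf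
      rw [← add_sub_cancel (c • G (k + 1)) f]
      exact Submodule.add_mem_sup (Submodule.smul_mem _ _ (Submodule.mem_span_singleton_self _)) hc

namespace EdwardsCurve
variable {F : Type*} [Field F] (E : EdwardsCurve F)

theorem algebraMap_eq (c : F) : algebraMap F E.FunctionField c =
    algebraMap E.CoordinateRing E.FunctionField (AdjoinRoot.of E.polynomial (C c)) := by
  rw [IsScalarTower.algebraMap_apply F E.CoordinateRing E.FunctionField, AdjoinRoot.algebraMap_eq']
  rfl

theorem degree_polynomial_ne_zero : E.polynomial.degree ≠ 0 := by
  have h : E.polynomial.coeff 2 = 1 - C E.d * X ^ 2 := by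
    rw [polynomial_eq]; exact (coeff_quadratic _ _ _).2.2
  intro h0
  have hlt : E.polynomial.degree < (2 : ℕ) := by rw [h0]; norm_num
  rw [coeff_eq_zero_of_degree_lt hlt] at h
  exact (separable_one_sub_C_mul_X_sq (d := E.d) E.two_ne_zero).ne_zero h.symm

theorem aeval_x (p : F[X]) : aeval E.x p =
    algebraMap E.CoordinateRing E.FunctionField (AdjoinRoot.of E.polynomial p) := by
  induction p using Polynomial.induction_on' with
  | add p q hp hq => simp only [map_add, hp, hq]
  | monomial n c =>
    rw [← C_mul_X_pow_eq_monomial]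
    simp only [map_mul, map_pow, aeval_C, aeval_X, algebraMap_eq]
    rfl

theorem isEdwardsPair : IsEdwardsPair E.d E.x E.y where
  two_ne_zero := E.two_ne_zero
  d_ne_zero := E.d_ne_zero
  d_ne_one := E.d_ne_one
  equation := by
    have h : AdjoinRoot.mk E.polynomial (C X ^ 2 + Y ^ 2 - (1 + C (C E.d) * C X ^ 2 * Y ^ 2)) = 0 :=
      AdjoinRoot.mk_self
    have h' := congrArg (algebraMap E.CoordinateRing E.FunctionField) h
    simp only [map_sub, map_add, map_mul, map_pow, map_one, map_zero, AdjoinRoot.mk_C,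
      AdjoinRoot.mk_X, ← E.algebraMap_eq] at h'
    exact sub_eq_zero.1 h'
  transcendental := by
    rw [transcendental_iff_injective]
    intro p q hpq
    rw [aeval_x, aeval_x] at hpq
    exact AdjoinRoot.of.injective_of_degree_ne_zero E.degree_polynomial_ne_zero
      (IsFractionRing.injective E.CoordinateRing E.FunctionField hpq)
  adjoin_eq_top := by
    rw [eq_top_iff]
    have hx : E.x ∈ IntermediateField.adjoin F {E.x, E.y} :=
      IntermediateField.subset_adjoin _ _ (Set.mem_insert _ _)
    have hy : E.y ∈ IntermediateField.adjoin F {E.x, E.y} :=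
      IntermediateField.subset_adjoin _ _ (Set.mem_insert_of_mem _ rfl)
    have key (r : E.CoordinateRing) : algebraMap E.CoordinateRing E.FunctionField r ∈
        IntermediateField.adjoin F {E.x, E.y} := by
      induction r using AdjoinRoot.induction_on with
      | ih p =>
        induction p using Polynomial.induction_on' with
        | add p q hp hq => rw [map_add, map_add]; exact add_mem hp hq
        | monomial n p =>
          rw [← C_mul_X_pow_eq_monomial, map_mul, map_pow, map_mul, map_pow, AdjoinRoot.mk_C,
            AdjoinRoot.mk_X, ← aeval_x]
          exact mul_mem (IntermediateField.algebra_adjoin_le_adjoin _ _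
            (Algebra.adjoin_mono (Set.singleton_subset_iff.2 (Set.mem_insert _ _))
              (aeval_mem_adjoin_singleton F E.x))) (pow_mem hy n)
    intro f _
    obtain ⟨r, s, -, rfl⟩ := IsFractionRing.div_surjective (A := E.CoordinateRing) f
    exact div_mem (key r) (key s)

variable {E}

theorem mem_riemannRochSpace_iff {D : E.Divisor} {f : E.FunctionField} :
    f ∈ riemannRochSpace D ↔ ∀ v : Place F E.FunctionField,
      v.val f ≤ WithZero.exp (D.coeffAt v) := by
  change (f = 0 ∨ ∀ v : Place F E.FunctionField, 0 ≤ v.ord f + D.coeffAt v) ↔ _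
  rcases eq_or_ne f 0 with rfl | hf
  · simp
  · simp only [hf, false_or, Place.le_ord_iff _ hf]

theorem eq_of_liesOver {v : Place F E.FunctionField} {P Q : E.AffinePoint} (hP : LiesOver v P)
    (hQ : LiesOver v Q) : P = Q := by
  have key {f : E.FunctionField} {a b : F} (ha : v.val (f - algebraMap F E.FunctionField a) < 1)
      (hb : v.val (f - algebraMap F E.FunctionField b) < 1) : a = b := by
    by_contra hab
    exact hb.ne (v.val_sub_eq_one_of_ne ha hab)
  exact AffinePoint.ext (key hP.1 hQ.1) (key hP.2 hQ.2)

open Classical in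
theorem coeffAt_single_add_smul_single (P Q : E.AffinePoint) (k : ℕ)
    (v : Place F E.FunctionField) :
    Divisor.coeffAt (Finsupp.single P 1 + (k : ℤ) • Finsupp.single Q 1 : E.Divisor) v =
      (if LiesOver v P then 1 else 0) + if LiesOver v Q then (k : ℤ) else 0 := by
  rw [Divisor.coeffAt, Finsupp.sum_add_index', Finsupp.smul_single, Finsupp.sum_single_index,
    Finsupp.sum_single_index, smul_eq_mul, mul_one]
  · simp
  · simp
  · simp
  · intro P m n
    split_ifs <;> simp

variable (E) in
/-- If there were no place over `O`, the nonconstant function `1 / (y - 1)` would have no poles. -/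
theorem exists_liesOver_O : ∃ v : Place F E.FunctionField, LiesOver v (AffinePoint.O E) := by
  by_contra! hO
  have h := E.isEdwardsPair
  obtain ⟨c, hc⟩ := h.exists_eq_algebraMap (f := 1 / (E.y - 1) ^ 1) (a := 0) (b := 0)
    fun v ↦ Or.inl (h.val_one_div_pow_le_one (hO v) 1)
  refine h.symm.sub_algebraMap_ne_zero (1 + c⁻¹) ?_
  rw [map_add, map_one, map_inv₀, ← hc]
  simp

theorem basisFun_zero (P : E.AffinePoint) : basisFun P 0 = 1 := by
  simp [basisFun]

theorem basisFun_two_mul (P : E.AffinePoint) {n : ℕ} (hn : n ≠ 0) :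
    basisFun P (2 * n) = 1 / (E.y - 1) ^ n := by
  have h1 : 2 * n ≠ 1 := by omega
  simp [basisFun, hn, h1]

theorem basisFun_two_mul_add_one (P : E.AffinePoint) {n : ℕ} (hn : n ≠ 0) :
    basisFun P (2 * n + 1) = (E.y + 1) / (E.x * (E.y - 1) ^ n) := by
  have h1 : (2 * n + 1) / 2 = n := by omega
  simp [basisFun, hn, h1]

theorem val_basisFun_of_two_le (P : E.AffinePoint) {i : ℕ} (hi : 2 ≤ i)
    (v : Place F E.FunctionField) :
    (LiesOver v (AffinePoint.O E) → v.val (basisFun P i) = WithZero.exp (i : ℤ)) ∧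
      (¬ LiesOver v (AffinePoint.O E) → v.val (basisFun P i) ≤ 1) := by
  have h := E.isEdwardsPair
  obtain ⟨n, rfl | rfl⟩ := i.even_or_odd'
  · rw [basisFun_two_mul P (by omega)]
    exact ⟨fun hO ↦ by simpa using h.val_one_div_pow hO n,
      fun hO ↦ h.val_one_div_pow_le_one hO n⟩
  · rw [basisFun_two_mul_add_one P (by omega)]
    exact ⟨fun hO ↦ by simpa using h.val_div_mul_pow hO n,
      fun hO ↦ h.val_div_mul_pow_le_one hO (by omega)⟩

theorem val_basisFun_one {P : E.AffinePoint} (hP : P ≠ AffinePoint.O E)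
    (v : Place F E.FunctionField) :
    (LiesOver v (AffinePoint.O E) → v.val (basisFun P 1) = WithZero.exp 1) ∧
      (¬ LiesOver v (AffinePoint.O E) → LiesOver v P → v.val (basisFun P 1) ≤ WithZero.exp 1) ∧
      (¬ LiesOver v (AffinePoint.O E) → ¬ LiesOver v P → v.val (basisFun P 1) ≤ 1) := by
  have h := E.isEdwardsPair
  simp only [basisFun, one_ne_zero, if_false, if_true]
  split_ifs with hO' hH hH'
  · subst hO'
    exact ⟨h.val_one_div, fun _ ↦ h.val_one_div_le, h.val_one_div_le_one⟩
  · subst hH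
    have hx : E.x + 1 = E.x - algebraMap F E.FunctionField (-1) := by simp
    have hc : (1 : F) ^ 2 = 1 := one_pow 2
    rw [hx]
    exact ⟨h.val_mul_div_mul hc, fun _ ↦ h.val_mul_div_mul_le hc, h.val_mul_div_mul_le_one hc⟩
  · subst hH'
    have hx : E.x - 1 = E.x - algebraMap F E.FunctionField (-(-1)) := by simp
    have hc : (-1 : F) ^ 2 = 1 := by ring
    rw [hx]
    exact ⟨h.val_mul_div_mul hc, fun _ ↦ h.val_mul_div_mul_le hc, h.val_mul_div_mul_le_one hc⟩
  · have ha : P.a ≠ 0 := by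
      intro ha
      have hb : (P.b - 1) * (P.b + 1) = 0 := by
        have := P.equation
        rw [ha] at this
        linear_combination this
      rcases mul_eq_zero.1 hb with hb | hb
      · exact hP (AffinePoint.ext ha (sub_eq_zero.1 hb))
      · exact hO' (AffinePoint.ext ha (eq_neg_of_add_eq_zero_left hb))
    have hb : P.b ≠ 0 := by
      intro hb
      have ha : (P.a - 1) * (P.a + 1) = 0 := by
        have := P.equation
        rw [hb] at this
        linear_combination this
      rcases mul_eq_zero.1 ha with ha | ha
      · exact hH (AffinePoint.ext (sub_eq_zero.1 ha) hb)
      · exact hH' (AffinePoint.ext (eq_neg_of_add_eq_zero_left ha) hb)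
    exact ⟨h.val_mul_div_mul_sub P.equation ha, fun _ ↦ h.val_mul_div_mul_sub_le P.equation ha hb,
      h.val_mul_div_mul_sub_le_one P.equation⟩

open Classical in
/-- A basis of `L(P + k O)` over an arbitrary base field. The shift `e` of the indices is the
multiplicity of `O` in the divisor `P`, so that `k + e` is the pole order at `O` allowed in
`L(P + k O)`. -/
theorem linearIndependent_and_span_basisFun (P : E.AffinePoint) {e : ℕ}
    (he : e = if P = AffinePoint.O E then 1 else 0) (k : ℕ) :
    LinearIndependent F
        (fun i : Fin (k + 1) => basisFun P (if (i : ℕ) = 0 then 0 else (i : ℕ) + e)) ∧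
      Submodule.span F
        (Set.range fun i : Fin (k + 1) => basisFun P (if (i : ℕ) = 0 then 0 else (i : ℕ) + e)) =
          riemannRochSpace (Finsupp.single P 1 + (k : ℤ) • Finsupp.single (AffinePoint.O E) 1) := by
  have h := E.isEdwardsPair
  have hOeq : (0 : F) ^ 2 + 1 ^ 2 = 1 + E.d * 0 ^ 2 * 1 ^ 2 := by ring
  obtain ⟨v₀, hv₀⟩ := E.exists_liesOver_O
  have ht := h.isUniformizerAt_sub hOeq one_ne_zero
  have ht0 := h.sub_algebraMap_ne_zero 0
  have hcoeffO (k : ℕ) {v : Place F E.FunctionField} (hv : LiesOver v (AffinePoint.O E)) :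
      Divisor.coeffAt (Finsupp.single P 1 + (k : ℤ) • Finsupp.single (AffinePoint.O E) 1) v =
        ((k + e : ℕ) : ℤ) := by
    rw [coeffAt_single_add_smul_single, if_pos hv, he]
    by_cases hP : P = AffinePoint.O E
    · rw [if_pos (hP ▸ hv), if_pos hP]; push_cast; ring
    · rw [if_neg fun hv' ↦ hP (eq_of_liesOver hv' hv), if_neg hP]; simp
  have hcoeff (k : ℕ) {v : Place F E.FunctionField} (hv : ¬ LiesOver v (AffinePoint.O E)) :
      Divisor.coeffAt (Finsupp.single P 1 + (k : ℤ) • Finsupp.single (AffinePoint.O E) 1) v =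
        if LiesOver v P then 1 else 0 := by
    rw [coeffAt_single_add_smul_single, if_neg hv, add_zero]
  have hval (k : ℕ) (v : Place F E.FunctionField) :
      (LiesOver v (AffinePoint.O E) →
        v.val (basisFun P (k + 1 + e)) = WithZero.exp ((k + 1 + e : ℕ) : ℤ)) ∧
      (¬ LiesOver v (AffinePoint.O E) →
        v.val (basisFun P (k + 1 + e)) ≤ WithZero.exp (if LiesOver v P then 1 else 0)) := by
    by_cases hi : 2 ≤ k + 1 + e
    · obtain ⟨h1, h2⟩ := val_basisFun_of_two_le P hi v
      refine ⟨h1, fun hv ↦ (h2 hv).trans ?_⟩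
      rw [← WithZero.exp_zero, WithZero.exp_le_exp]
      split_ifs <;> norm_num
    · have he0 : e = 0 := by omega
      have hk0 : k = 0 := by omega
      subst he0 hk0
      have hP : P ≠ AffinePoint.O E := fun hP ↦ by rw [if_pos hP] at he; omega
      obtain ⟨h1, h2, h3⟩ := val_basisFun_one hP v
      refine ⟨h1, fun hv ↦ ?_⟩
      split_ifs with hvP
      · exact h2 hv hvP
      · exact h3 hv hvP
  refine linearIndependent_and_span_eq_of_filtration
    (N := fun k ↦ riemannRochSpace
      (Finsupp.single P 1 + (k : ℤ) • Finsupp.single (AffinePoint.O E) 1))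
    (G := fun i ↦ basisFun P (if i = 0 then 0 else i + e)) ?_ ?_ ?_ ?_ ?_ ?_ k
  · simp only [if_true, basisFun_zero]
    refine le_antisymm (fun f hf ↦ ?_) ?_
    · rw [mem_riemannRochSpace_iff] at hf
      obtain ⟨c, rfl⟩ := h.exists_eq_algebraMap (f := f) (a := P.a) (b := P.b) fun v ↦ by
        have := hf v
        rw [coeffAt_single_add_smul_single] at this
        by_cases hv : LiesOver v P
        · exact Or.inr ⟨by simpa [hv] using this, hv⟩
        · exact Or.inl (by simpa [hv] using this)
      exact Submodule.mem_span_singleton.2 ⟨c, (Algebra.algebraMap_eq_smul_one c).symm⟩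
    · rw [Submodule.span_singleton_le_iff_mem, mem_riemannRochSpace_iff]
      intro v
      rw [coeffAt_single_add_smul_single, map_one, ← WithZero.exp_zero, WithZero.exp_le_exp]
      split_ifs <;> simp
  · simp [basisFun_zero]
  · intro k f hf
    rw [mem_riemannRochSpace_iff] at hf ⊢
    refine fun v ↦ (hf v).trans ?_
    rw [WithZero.exp_le_exp, coeffAt_single_add_smul_single, coeffAt_single_add_smul_single]
    split_ifs <;> push_cast <;> omega
  · intro k
    simp only [Nat.add_eq_zero_iff, one_ne_zero, and_false, if_false]
    rw [mem_riemannRochSpace_iff]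
    intro v
    by_cases hv : LiesOver v (AffinePoint.O E)
    · rw [hcoeffO _ hv, (hval k v).1 hv]
    · rw [hcoeff _ hv]; exact (hval k v).2 hv
  · intro k
    simp only [Nat.add_eq_zero_iff, one_ne_zero, and_false, if_false]
    rw [mem_riemannRochSpace_iff]
    intro hmem
    have := hmem v₀
    rw [hcoeffO _ hv₀, (hval k v₀).1 hv₀, WithZero.exp_le_exp] at this
    omega
  · intro k f hf
    simp only [Nat.add_eq_zero_iff, one_ne_zero, and_false, if_false]
    simp only [mem_riemannRochSpace_iff] at hf ⊢
    set g := basisFun P (k + 1 + e)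
    have hg : v₀.val g = WithZero.exp ((k + 1 + e : ℕ) : ℤ) := (hval k v₀).1 hv₀
    have hg0 : g ≠ 0 := fun h0 ↦ WithZero.exp_ne_zero (by rw [← hg, h0, map_zero])
    -- The value of `f / g` at `O` is the coefficient of `g` that has to be split off.
    obtain ⟨c, hc⟩ := ht.exists_val_sub_lt_one h.adjoin_eq_top hv₀ ht0 (f := f / g) (by
      rw [map_div₀, hg]
      have := hf v₀
      rw [hcoeffO _ hv₀] at this
      exact div_le_one_of_le₀ this zero_le)
    refine ⟨c, fun v ↦ ?_⟩
    by_cases hv : LiesOver v (AffinePoint.O E)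
    · rw [hcoeffO _ hv, ht.val_eq_val h.adjoin_eq_top hv ht0 hv₀]
      have : f - c • g = (f / g - algebraMap F E.FunctionField c) * g := by
        rw [Algebra.smul_def]; field_simp
      rw [this, map_mul, hg]
      calc _ ≤ WithZero.exp (-1) * WithZero.exp ((k + 1 + e : ℕ) : ℤ) :=
            mul_le_mul_left (WithZero.le_exp_neg_one_of_lt_one hc) _
        _ = WithZero.exp ((k + e : ℕ) : ℤ) := by
            rw [← WithZero.exp_add]; congr 1; push_cast; ring
    · rw [hcoeff _ hv]
      refine (v.val.map_sub _ _).trans (max_le ?_ ?_)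
      · rw [← hcoeff (k + 1) hv]; exact hf v
      · rw [Algebra.smul_def, map_mul]
        exact mul_le_of_le_one_of_le (v.val_algebraMap_le_one c) ((hval k v).2 hv)

end EdwardsCurve

theorem mainTheorem1 {K : Type*} [Field K] (Kbar : Type*) [Field Kbar] [Algebra K Kbar]
    [IsAlgClosure K Kbar] (E : EdwardsCurve K) (hd : ¬ IsSquare E.d) (P : E.AffinePoint) (k : ℕ)
    (D : (E.baseChange Kbar).Divisor)
    (hD : D = Finsupp.single (P.baseChange Kbar) 1 +
      (k : ℤ) • Finsupp.single ((EdwardsCurve.AffinePoint.O E).baseChange Kbar) 1) :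
    Module.finrank Kbar (EdwardsCurve.riemannRochSpace D) = k + 1 ∧
    (P ≠ EdwardsCurve.AffinePoint.O E →
      LinearIndependent Kbar
        (fun i : Fin (k + 1) => EdwardsCurve.basisFun (P.baseChange Kbar) i) ∧
      Submodule.span Kbar
        (Set.range fun i : Fin (k + 1) => EdwardsCurve.basisFun (P.baseChange Kbar) i) =
          EdwardsCurve.riemannRochSpace D) ∧
    (P = EdwardsCurve.AffinePoint.O E →
      LinearIndependent Kbar
        (fun i : Fin (k + 1) => EdwardsCurve.basisFun (P.baseChange Kbar)
          (if (i : ℕ) = 0 then 0 else (i : ℕ) + 1)) ∧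
      Submodule.span Kbar
        (Set.range fun i : Fin (k + 1) => EdwardsCurve.basisFun (P.baseChange Kbar)
          (if (i : ℕ) = 0 then 0 else (i : ℕ) + 1)) =
          EdwardsCurve.riemannRochSpace D) := by
  classical
  have hO : (EdwardsCurve.AffinePoint.O E).baseChange Kbar =
      EdwardsCurve.AffinePoint.O (E.baseChange Kbar) :=
    EdwardsCurve.AffinePoint.ext (map_zero _) (map_one _)
  have hPO : P.baseChange Kbar = EdwardsCurve.AffinePoint.O (E.baseChange Kbar) ↔
      P = EdwardsCurve.AffinePoint.O E := by
    rw [← hO]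
    refine ⟨fun h ↦ EdwardsCurve.AffinePoint.ext ?_ ?_, fun h ↦ by rw [h]⟩
    · exact (algebraMap K Kbar).injective (congrArg EdwardsCurve.AffinePoint.a h)
    · exact (algebraMap K Kbar).injective (congrArg EdwardsCurve.AffinePoint.b h)
  rw [hO] at hD
  subst hD
  have key := EdwardsCurve.linearIndependent_and_span_basisFun (P.baseChange Kbar) rfl k
  refine ⟨?_, fun hP ↦ ?_, fun hP ↦ ?_⟩
  · rw [← key.2, finrank_span_eq_card key.1, Fintype.card_fin]
  · rw [if_neg (hPO.not.2 hP)] at key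
    have hi (i : ℕ) : (if i = 0 then 0 else i + 0) = i := by split_ifs <;> omega
    simpa only [hi] using key
  · rwa [if_pos (hPO.2 hP)] at key
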